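/- **Setting.** We consider the following balanced one-, two- and three-way ANOVA models with fixed factor $A$ with $a\ge 2$ levels, and the exact level-$\alpha$ $F$-test ($0<\alpha<1$) of the hypothesis that $A$ has no effect. Here $\times$ means crossed (with interaction), $X\succ Y$ means that $Y$ is nested in $X$, bold factors are random. The numbers of levels $u,v,b,c$ of the factors $U,V,B,C$ that occur in the model and the number $n$ of replicates are called *parameters*; they may be real numbers. The *size* of a design is the product of $a$ and all parameters of the model. With the degrees of freedom $\mathit{df}_1,\mathit{df}_2$ and the noncentrality parameter $\lambda=RS/T$ given in the table, the *power* is $\mathbb P(F>q)$, where $F$ has the noncentral $F$-distribution with $\mathit{df}_1,\mathit{df}_2$ degrees of freedom and noncentrality $\lambda$, and $q$ is the $(1-\alpha)$-quantile of the central $F$-distribution with the same degrees of freedom (for real degrees of freedom, $\chi^2(k,\lambda)$ is the Poisson$(\lambda/2)$-mixture of the Gamma distributions with shape $k/2+j$ and rate $1/2$). | Models | pivot | $\mathit{df}_1$ | $\mathit{df}_2$ | $R$ | $T$ | |---|---|---|---|---|---| | $A$ | $n$ | $a-1$ | $a(n-1)$ | $n$ | $\sigma^2$ | | $A\times B$;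 $A\succ B$ | $n$ | $a-1$ | $ab(n-1)$ | $bn$ | $\sigma^2$ | | $A\times\mathbf B$ | $b$ | $a-1$ | $(a-1)(b-1)$ | $b$ | $\sigma^2_{\alpha,\beta}+\frac1n\sigma^2$ | | $A\succ\mathbf B$ | $b$ | $a-1$ | $a(b-1)$ | $b$ | $\sigma^2_{\alpha,\beta}+\frac1n\sigma^2$ | | $V\succ A$; $\mathbf V\succ A$ | $n$ | $v(a-1)$ | $va(n-1)$ | $n$ | $\sigma^2$ | | $A\times B\times C$; $A\succ B\succ C$; $(A\times B)\succ C$; $(A\succ B)\times C$; $A\times(B\succ C)$ | $n$ | $a-1$ | $abc(n-1)$ | $bcn$ | $\sigma^2$ | | $A\succ B\succ\mathbf C$; $(A\times B)\succ\mathbf C$ | $c$ | $a-1$ | $ab(c-1)$ | $bc$ | $\sigma^2_{\alpha,\beta,\gamma}+\frac1n\sigma^2$ | | $A\times(B\succ\mathbf C)$ | $c$ | $a-1$ | $(a-1)b(c-1)$ | $bc$ | $\sigma^2_{\alpha,\beta,\gamma}+\frac1n\sigma^2$ | | $(A\succ B)\times\mathbf C$ | $c$ | $a-1$ | $(a-1)(c-1)$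 | $c$ | $\sigma^2_{\alpha,\gamma}+\frac1{bn}\sigma^2$ | | $A\times\mathbf B\times C$; $(A\times\mathbf B)\succ C$; $A\times(\mathbf B\succ C)$ | $b$ | $a-1$ | $(a-1)(b-1)$ | $b$ | $\sigma^2_{\alpha,\beta}+\frac1{cn}\sigma^2$ | | $A\succ\mathbf B\succ C$; $(A\succ\mathbf B)\times C$ | $b$ | $a-1$ | $a(b-1)$ | $b$ | $\sigma^2_{\alpha,\beta}+\frac1{cn}\sigma^2$ | | $A\succ\mathbf B\succ\mathbf C$ | $b$ | $a-1$ | $a(b-1)$ | $b$ | $\sigma^2_{\alpha,\beta}+\frac1c\sigma^2_{\alpha,\beta,\gamma}+\frac1{cn}\sigma^2$ | | $(A\times\mathbf B)\succ\mathbf C$; $A\times(\mathbf B\succ\mathbf C)$ | $b$ | $a-1$ | $(a-1)(b-1)$ | $b$ | $\sigma^2_{\alpha,\beta}+\frac1c\sigma^2_{\alpha,\beta,\gamma}+\frac1{cn}\sigma^2$ | | $V\succ A\succ B$; $(V\succ A)\times B$; $\mathbf V\succ A\succ B$; $(\mathbf V\succ A)\times B$ | $n$ | $v(a-1)$ | $vab(n-1)$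 | $bn$ | $\sigma^2$ | | $V\succ A\succ\mathbf B$; $\mathbf V\succ A\succ\mathbf B$ | $b$ | $v(a-1)$ | $va(b-1)$ | $b$ | $\sigma^2_{\nu,\alpha,\beta}+\frac1n\sigma^2$ | | $(V\succ A)\times\mathbf B$; $(\mathbf V\succ A)\times\mathbf B$ | $b$ | $v(a-1)$ | $v(a-1)(b-1)$ | $b$ | $\sigma^2_{\nu,\alpha,\beta}+\frac1n\sigma^2$ | | $U\succ V\succ A$; $(U\times V)\succ A$; $\mathbf U\succ V\succ A$; $U\succ\mathbf V\succ A$; $(U\times\mathbf V)\succ A$; $\mathbf U\succ\mathbf V\succ A$; $(\mathbf U\times\mathbf V)\succ A$ | $n$ | $uv(a-1)$ | $uva(n-1)$ | $n$ | $\sigma^2$ | The variance components are fixed and nonnegative, and those that occur in $T$ are not all zero. $S$ is the sum of squares of the main effects of $A$. As the parameters vary, one of the following positive numbers is kept fixed: the value of $S$; or the mean of the squared effects ($S$ is then this mean times the number $a$, $va$, resp. $uva$ of effects); or the difference $\delta$ between the largest and the smallest effect, the effects being otherwise least favorable, that is, $S=\frac{\delta^2}2$ if $A$ is not nested, $S=\frac{\delta^2}2\cdot\frac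 m{m-1}$ with $m=\max(v,a)$ if $A$ is nested in $V$ only, and $S=\frac{\delta^2}2\cdot\frac{m_2m_3}{(m_2-1)(m_3-1)}$ if $A$ is nested in $U$ and $V$, where $m_1\le m_2\le m_3$ are $a,u,v$ in increasing order. Fix a minimal value $L_x>1$ for each parameter $x$ (for example $L_x=2$), and consider the designs, i.e. assignments of real values $\ge L_x$ to the parameters. "Only the pivot varies" means that every parameter other than the pivot has its minimal value. **Theorem.** For each model in the table the following hold. 1. Let $t>1$. Multiplying the pivot parameter of a design by $t$ strictly increases the power, and the resulting power is strictly greater than the power obtained by multiplying any other parameter by $t$. 2. For each size $N$ not less than the size of the design $L$, there is a design of size $N$ in which only the pivot varies, and a design of size $N$ has maximal power among all designs of size $N$ if and only if only the pivot varies. 3. For each $P$ not less than the power of the design $L$ that is the power of some design, there is a design of power $P$ in which only the pivot varies, and a design of power $P$ has minimal size among all designs of power $P$ if and only if only the pivot varies. Likewise, for each $P$ such that some design has power at least $P$, the minimal size among all designs of power at least $P$ is attained, and only by designs in which only the pivot varies. -/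

import Mathlib

open MeasureTheory ProbabilityTheory Set

/-! ### The `F`-test and its power -/

/-- The noncentral chi-squared distribution with `k` degrees of freedom and noncentrality `l`
(`k > 0` real, `l ≥ 0`): the Poisson(`l / 2`) mixture of the central chi-squared distributions with
`k + 2 * j` degrees of freedom, i.e. of the Gamma distributions of shape `k / 2 + j`, rate `1 / 2`.
For `l = 0` it is the central chi-squared distribution. -/
noncomputable def noncentralChiSq (k l : ℝ) : Measure ℝ :=
  Measure.sum fun j : ℕ =>
    ENNReal.ofReal (Real.exp (-(l / 2)) * (l / 2) ^ j / (j.factorial : ℝ)) •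
      gammaMeasure (k / 2 + j) (1 / 2)

/-- The noncentral `F`-distribution: the law of `(X₁ / ν₁) / (X₂ / ν₂)` with independent
`X₁ ∼ χ²(ν₁, l)` and `X₂ ∼ χ²(ν₂, 0)`. -/
noncomputable def noncentralF (ν₁ ν₂ l : ℝ) : Measure ℝ :=
  ((noncentralChiSq ν₁ l).prod (noncentralChiSq ν₂ 0)).map
    fun x : ℝ × ℝ => (x.1 / ν₁) / (x.2 / ν₂)

/-- The `p`-quantile of a probability distribution on the real line. -/
noncomputable def quantile (μ : Measure ℝ) (p : ℝ) : ℝ :=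
  sInf {x : ℝ | p ≤ cdf μ x}

/-- The power of the level-`α` `F`-test: the probability that a noncentral `F` variable exceeds
the `(1 - α)`-quantile of the central `F`-distribution. -/
noncomputable def fTestPower (α ν₁ ν₂ l : ℝ) : ℝ :=
  (noncentralF ν₁ ν₂ l).real (Ioi (quantile (noncentralF ν₁ ν₂ 0) (1 - α)))

/-! ### The models -/

/-- The parameters: numbers of levels `u, v, b, c` of the factors `U, V, B, C`,
and the number `n` of replicates. -/
inductive Param
  | u | v | b | c | n
  deriving DecidableEq

/-- The (combined notation for the) variance components: `err` is the error variance `σ²`,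
`ab` is `σ²_{α,β}`, `ac` is `σ²_{α,γ}`, `abc` is `σ²_{α,β,γ}`, `vab` is `σ²_{ν,α,β}`. -/
inductive VarComp
  | err | ab | ac | abc | vab

/-- The models with an exact `F`-test for the fixed factor `A`. In the names, `x` means crossed
with interaction (`×`), `o` means "the right factor is nested in the left one" (`≻`), a factor
prefixed by `r` is random, and `_` separates a bracketed group from the rest. -/
inductive Model
  /-- `A` -/
  | A
  /-- `A × B` -/
  | AxB
  /-- `A ≻ B` -/
  | AoB
  /-- `A × 𝐁` -/
  | AxrB
  /-- `A ≻ 𝐁` -/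
  | AorB
  /-- `V ≻ A` -/
  | VoA
  /-- `𝐕 ≻ A` -/
  | rVoA
  /-- `A × B × C` -/
  | AxBxC
  /-- `A ≻ B ≻ C` -/
  | AoBoC
  /-- `(A × B) ≻ C` -/
  | AxB_oC
  /-- `(A ≻ B) × C` -/
  | AoB_xC
  /-- `A × (B ≻ C)` -/
  | Ax_BoC
  /-- `A ≻ B ≻ 𝐂` -/
  | AoBorC
  /-- `(A × B) ≻ 𝐂` -/
  | AxB_orC
  /-- `A × (B ≻ 𝐂)` -/
  | Ax_BorC
  /-- `(A ≻ B) × 𝐂` -/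
  | AoB_xrC
  /-- `A × 𝐁 × C` -/
  | AxrBxC
  /-- `(A × 𝐁) ≻ C` -/
  | AxrB_oC
  /-- `A × (𝐁 ≻ C)` -/
  | Ax_rBoC
  /-- `A ≻ 𝐁 ≻ C` -/
  | AorBoC
  /-- `(A ≻ 𝐁) × C` -/
  | AorB_xC
  /-- `A ≻ 𝐁 ≻ 𝐂` -/
  | AorBorC
  /-- `(A × 𝐁) ≻ 𝐂` -/
  | AxrB_orC
  /-- `A × (𝐁 ≻ 𝐂)` -/
  | Ax_rBorC
  /-- `V ≻ A ≻ B` -/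
  | VoAoB
  /-- `(V ≻ A) × B` -/
  | VoA_xB
  /-- `𝐕 ≻ A ≻ B` -/
  | rVoAoB
  /-- `(𝐕 ≻ A) × B` -/
  | rVoA_xB
  /-- `V ≻ A ≻ 𝐁` -/
  | VoAorB
  /-- `𝐕 ≻ A ≻ 𝐁` -/
  | rVoAorB
  /-- `(V ≻ A) × 𝐁` -/
  | VoA_xrB
  /-- `(𝐕 ≻ A) × 𝐁` -/
  | rVoA_xrB
  /-- `U ≻ V ≻ A` -/
  | UoVoA
  /-- `(U × V) ≻ A` -/
  | UxV_oA
  /-- `𝐔 ≻ V ≻ A` -/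
  | rUoVoA
  /-- `U ≻ 𝐕 ≻ A` -/
  | UorVoA
  /-- `(U × 𝐕) ≻ A` -/
  | UxrV_oA
  /-- `𝐔 ≻ 𝐕 ≻ A` -/
  | rUorVoA
  /-- `(𝐔 × 𝐕) ≻ A` -/
  | rUxrV_oA

namespace Model

/-- The parameters of a model. -/
def params : Model → Finset Param
  | A => {.n}
  | AxB | AoB | AxrB | AorB => {.b, .n}
  | VoA | rVoA => {.v, .n}
  | AxBxC | AoBoC | AxB_oC | AoB_xC | Ax_BoC
  | AoBorC | AxB_orC | Ax_BorC | AoB_xrC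
  | AxrBxC | AxrB_oC | Ax_rBoC | AorBoC | AorB_xC
  | AorBorC | AxrB_orC | Ax_rBorC => {.b, .c, .n}
  | VoAoB | VoA_xB | rVoAoB | rVoA_xB
  | VoAorB | rVoAorB | VoA_xrB | rVoA_xrB => {.v, .b, .n}
  | UoVoA | UxV_oA | rUoVoA | UorVoA | UxrV_oA | rUorVoA | rUxrV_oA => {.u, .v, .n}

/-- The pivot parameter of a model. -/
def pivot : Model → Param
  | A | AxB | AoB | VoA | rVoA => .n
  | AxBxC | AoBoC | AxB_oC | AoB_xC | Ax_BoC => .n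
  | VoAoB | VoA_xB | rVoAoB | rVoA_xB => .n
  | UoVoA | UxV_oA | rUoVoA | UorVoA | UxrV_oA | rUorVoA | rUxrV_oA => .n
  | AoBorC | AxB_orC | Ax_BorC | AoB_xrC => .c
  | AxrB | AorB
  | AxrBxC | AxrB_oC | Ax_rBoC | AorBoC | AorB_xC
  | AorBorC | AxrB_orC | Ax_rBorC
  | VoAorB | rVoAorB | VoA_xrB | rVoA_xrB => .b

/-- Numerator degrees of freedom; `a` is the number of levels of `A` and `d` assigns real values
to the parameters. -/
def df₁ (m : Model) (a : ℝ) (d : Param → ℝ) : ℝ :=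
  match m with
  | A | AxB | AoB | AxrB | AorB
  | AxBxC | AoBoC | AxB_oC | AoB_xC | Ax_BoC
  | AoBorC | AxB_orC | Ax_BorC | AoB_xrC
  | AxrBxC | AxrB_oC | Ax_rBoC | AorBoC | AorB_xC
  | AorBorC | AxrB_orC | Ax_rBorC => a - 1
  | VoA | rVoA
  | VoAoB | VoA_xB | rVoAoB | rVoA_xB
  | VoAorB | rVoAorB | VoA_xrB | rVoA_xrB => d .v * (a - 1)
  | UoVoA | UxV_oA | rUoVoA | UorVoA | UxrV_oA | rUorVoA | rUxrV_oA => d .u * d .v * (a - 1)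

/-- Denominator degrees of freedom. -/
def df₂ (m : Model) (a : ℝ) (d : Param → ℝ) : ℝ :=
  match m with
  | A => a * (d .n - 1)
  | AxB | AoB => a * d .b * (d .n - 1)
  | AxrB => (a - 1) * (d .b - 1)
  | AorB => a * (d .b - 1)
  | VoA | rVoA => d .v * a * (d .n - 1)
  | AxBxC | AoBoC | AxB_oC | AoB_xC | Ax_BoC => a * d .b * d .c * (d .n - 1)
  | AoBorC | AxB_orC => a * d .b * (d .c - 1)
  | Ax_BorC => (a - 1) * d .b * (d .c - 1)
  | AoB_xrC => (a - 1) * (d .c - 1)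
  | AxrBxC | AxrB_oC | Ax_rBoC => (a - 1) * (d .b - 1)
  | AorBoC | AorB_xC => a * (d .b - 1)
  | AorBorC => a * (d .b - 1)
  | AxrB_orC | Ax_rBorC => (a - 1) * (d .b - 1)
  | VoAoB | VoA_xB | rVoAoB | rVoA_xB => d .v * a * d .b * (d .n - 1)
  | VoAorB | rVoAorB => d .v * a * (d .b - 1)
  | VoA_xrB | rVoA_xrB => d .v * (a - 1) * (d .b - 1)
  | UoVoA | UxV_oA | rUoVoA | UorVoA | UxrV_oA | rUorVoA | rUxrV_oA =>
      d .u * d .v * a * (d .n - 1)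

/-- The factor `R` of the noncentrality parameter `R * S / T`. -/
def R (m : Model) (d : Param → ℝ) : ℝ :=
  match m with
  | A => d .n
  | AxB | AoB => d .b * d .n
  | AxrB | AorB => d .b
  | VoA | rVoA => d .n
  | AxBxC | AoBoC | AxB_oC | AoB_xC | Ax_BoC => d .b * d .c * d .n
  | AoBorC | AxB_orC | Ax_BorC => d .b * d .c
  | AoB_xrC => d .c
  | AxrBxC | AxrB_oC | Ax_rBoC | AorBoC | AorB_xC => d .b
  | AorBorC | AxrB_orC | Ax_rBorC => d .b
  | VoAoB | VoA_xB | rVoAoB | rVoA_xB => d .b * d .n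
  | VoAorB | rVoAorB | VoA_xrB | rVoA_xrB => d .b
  | UoVoA | UxV_oA | rUoVoA | UorVoA | UxrV_oA | rUorVoA | rUxrV_oA => d .n

/-- The denominator `T` of the noncentrality parameter `R * S / T`; `s` assigns their values to the
variance components. -/
noncomputable def T (m : Model) (s : VarComp → ℝ) (d : Param → ℝ) : ℝ :=
  match m with
  | A | AxB | AoB | VoA | rVoA => s .err
  | AxrB | AorB => s .ab + 1 / d .n * s .err
  | AxBxC | AoBoC | AxB_oC | AoB_xC | Ax_BoC => s .err
  | AoBorC | AxB_orC | Ax_BorC => s .abc + 1 / d .n * s .err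
  | AoB_xrC => s .ac + 1 / (d .b * d .n) * s .err
  | AxrBxC | AxrB_oC | Ax_rBoC | AorBoC | AorB_xC => s .ab + 1 / (d .c * d .n) * s .err
  | AorBorC | AxrB_orC | Ax_rBorC =>
      s .ab + 1 / d .c * s .abc + 1 / (d .c * d .n) * s .err
  | VoAoB | VoA_xB | rVoAoB | rVoA_xB => s .err
  | VoAorB | rVoAorB | VoA_xrB | rVoA_xrB => s .vab + 1 / d .n * s .err
  | UoVoA | UxV_oA | rUoVoA | UorVoA | UxrV_oA | rUorVoA | rUxrV_oA => s .err

/-- The active variance: the sum of the variance components that occur in `T`, i.e. the expression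
`T` with every parameter in it replaced by `1`. -/
noncomputable def activeVariance (m : Model) (s : VarComp → ℝ) : ℝ :=
  m.T s fun _ => 1

/-- The size of an experiment: the product of the numbers of levels of all factors of the model
(including `A`) and of the number of replicates. -/
def size (m : Model) (a : ℝ) (d : Param → ℝ) : ℝ :=
  a * ∏ x ∈ m.params, d x

/-- The number of main effects of `A` in the model: `a`, `v * a` or `u * v * a`, according to the
factors that `A` is nested in. -/
def effectCount (m : Model) (a : ℝ) (d : Param → ℝ) : ℝ :=
  match m with
  | VoA | rVoA
  | VoAoB | VoA_xB | rVoAoB | rVoA_xB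
  | VoAorB | rVoAorB | VoA_xrB | rVoA_xrB => d .v * a
  | UoVoA | UxV_oA | rUoVoA | UorVoA | UxrV_oA | rUorVoA | rUxrV_oA => d .u * d .v * a
  | _ => a

/-- The sharp lower bound for the sum of squares of the main effects of `A` when the largest and
the smallest of them differ by `δ` and they have zero mean in all directions: `δ² / 2` for models
in which `A` is not nested, `δ² / 2 * (m / (m - 1))` with `m = max v a` if `A` is nested in `V`, and
`δ² / 2 * (m₂ * m₃ / ((m₂ - 1) * (m₃ - 1)))` if `A` is nested in `U` and `V`, where `m₁ ≤ m₂ ≤ m₃`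
are the numbers `a, u, v` in increasing order. -/
noncomputable def leastSumSq (m : Model) (a δ : ℝ) (d : Param → ℝ) : ℝ :=
  match m with
  | VoA | rVoA
  | VoAoB | VoA_xB | rVoAoB | rVoA_xB
  | VoAorB | rVoAorB | VoA_xrB | rVoA_xrB =>
      δ ^ 2 / 2 * (max (d .v) a / (max (d .v) a - 1))
  | UoVoA | UxV_oA | rUoVoA | UorVoA | UxrV_oA | rUorVoA | rUxrV_oA =>
      let m₁ := min a (min (d .u) (d .v))
      let m₃ := max a (max (d .u) (d .v))
      let m₂ := a + d .u + d .v - m₁ - m₃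
      δ ^ 2 / 2 * (m₂ * m₃ / ((m₂ - 1) * (m₃ - 1)))
  | _ => δ ^ 2 / 2

end Model

/-- What is kept fixed about the (not all vanishing) main effects of `A` when the parameters vary.
-/
inductive Effects
  /-- the sum of squares of the effects -/
  | sumSq (S : ℝ)
  /-- the mean of the squares of the effects -/
  | meanSq (q : ℝ)
  /-- the difference `δ` between the largest and the smallest effect, the effects being
  least favorable otherwise (guaranteed power) -/
  | leastFavorable (δ : ℝ)

namespace Effects

/-- The number that specifies the effects is positive, so that the null hypothesis fails. -/
def Pos : Effects → Prop
  | sumSq S => 0 < S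
  | meanSq q => 0 < q
  | leastFavorable δ => 0 < δ

/-- The sum `S` of squares of the main effects of `A`. -/
noncomputable def S (e : Effects) (m : Model) (a : ℝ) (d : Param → ℝ) : ℝ :=
  match e with
  | sumSq S => S
  | meanSq q => q * m.effectCount a d
  | leastFavorable δ => m.leastSumSq a δ d

end Effects

namespace Model

/-- The noncentrality parameter `R * S / T`. -/
noncomputable def noncentrality (m : Model) (a : ℝ) (e : Effects) (s : VarComp → ℝ)
    (d : Param → ℝ) : ℝ :=
  m.R d * e.S m a d / m.T s d

/-- The power of the level-`α` `F`-test of the hypothesis that `A` has no effect. -/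
noncomputable def power (m : Model) (a α : ℝ) (e : Effects) (s : VarComp → ℝ)
    (d : Param → ℝ) : ℝ :=
  fTestPower α (m.df₁ a d) (m.df₂ a d) (m.noncentrality a e s d)

/-- The designs whose parameters are real numbers not below the prescribed minimal values `L`. -/
def designs (m : Model) (L : Param → ℝ) : Set (Param → ℝ) :=
  {d | ∀ x ∈ m.params, L x ≤ d x}

/-- All parameters except possibly the pivot have their minimal values. -/
def OnlyPivotVaries (m : Model) (L d : Param → ℝ) : Prop :=
  ∀ x ∈ m.params, x ≠ m.pivot → d x = L x

/-- The design `d` with the parameter `x` multiplied by `t`. -/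
def scale (d : Param → ℝ) (x : Param) (t : ℝ) : Param → ℝ :=
  Function.update d x (t * d x)

end Model

/-! Conditioning on the Poisson variable writes the power as a mixture of the terms `powerTerm α a b
j` = P(X > kY), where X and Y are independent Gamma variables of shapes a + j and b (half the
degrees of freedom, shifted by j), and k is critical for j = 0. The analytic core is `powerTerm_lt`:
if b grows, a does not grow and a + b does not shrink, then no term decreases and every term with j
≥ 1 strictly increases.

This is proved by induction on j. At j = 0 both terms equal α. For the step, both tests are realised
on one triple of independent Gamma variables, the third carrying the shape that is moved or added.
Both rejection regions are then cones, and the favoured one is x₁ > l(x₂ + x₃). On cones, raising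
the first shape by one amounts to weighting by a multiple of x₁/(x₁ + x₂ + x₃), and the favoured
region is a superlevel set of this weight. So the Neyman–Pearson argument `gammaTriple_cone_lt`
turns "at least as large at j" into "strictly larger at j + 1". Since the terms are monotone in j
and Poisson laws increase stochastically with their mean, a larger noncentrality does not lower the
power; together this is `fTestPower_lt`.

For the models, multiplying the pivot by t fixes `df₁`, multiplies the noncentrality by exactly t,
and turns c(p - 1) into c(tp - 1) in `df₂`. Any other parameter multiplies the noncentrality by at
most t and gives a smaller `df₂`; if it increases `df₁`, the sum of the degrees of freedom is still
no larger than for the pivot. This is the first claim.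

For the others, the excess of each non-pivot parameter over its minimum is shifted to the pivot,
keeping the size and raising the power. Every design is thus compared with the ray t ↦ `scale L
m.pivot t`, along which the size is linear and the power continuous and strictly increasing. The
extremal statements follow from monotonicity and the intermediate value theorem on this ray. -/

open scoped ENNReal Topology

/-! ### Gamma distributions: exponential tilting, convolution, size bias -/

/-- The Gamma distribution of shape `p` and rate `1 / 2`. -/
noncomputable abbrev halfGamma (p : ℝ) : Measure ℝ := gammaMeasure p (1 / 2)

instance halfGamma.instSFinite (p : ℝ) : SFinite (halfGamma p) := by
  unfold halfGamma gammaMeasure; infer_instance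

instance halfGamma.instNullSingletonClass (p : ℝ) : NullSingletonClass (halfGamma p) := by
  unfold halfGamma gammaMeasure; infer_instance

lemma isProbabilityMeasure_halfGamma {p : ℝ} (hp : 0 < p) : IsProbabilityMeasure (halfGamma p) :=
  isProbabilityMeasure_gammaMeasure hp (by norm_num)

lemma measurable_gammaPDF (p r : ℝ) : Measurable (gammaPDF p r) :=
  (measurable_gammaPDFReal p r).ennreal_ofReal

lemma lintegral_halfGamma (p : ℝ) {g : ℝ → ℝ≥0∞} (hg : Measurable g) :
    ∫⁻ x, g x ∂(halfGamma p) = ∫⁻ x, gammaPDF p (1 / 2) x * g x := by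
  rw [halfGamma, gammaMeasure, lintegral_withDensity_eq_lintegral_mul _ (measurable_gammaPDF _ _) hg]
  rfl

lemma ae_halfGamma_pos (p : ℝ) : ∀ᵐ x ∂(halfGamma p), 0 < x := by
  have h0 : halfGamma p (Iio 0) = 0 := by
    rw [halfGamma, gammaMeasure, withDensity_apply _ measurableSet_Iio,
      lintegral_gammaPDF_of_nonpos le_rfl]
  have : halfGamma p (Iic 0) = 0 := by
    rw [← Iio_union_right]
    exact measure_union_null h0 (measure_singleton 0)
  rw [ae_iff]
  convert this using 2
  ext x; simp

lemma halfGamma_Ioo_pos {p x y : ℝ} (hp : 0 < p) (hx : 0 ≤ x) (hxy : x < y) :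
    0 < halfGamma p (Ioo x y) := by
  rw [halfGamma, gammaMeasure, withDensity_apply _ measurableSet_Ioo,
    setLIntegral_pos_iff (measurable_gammaPDF _ _)]
  have : Function.support (gammaPDF p (1 / 2)) ∩ Ioo x y = Ioo x y := by
    refine inter_eq_right.2 fun z hz => ?_
    have := gammaPDFReal_pos hp (r := 1 / 2) (by norm_num) (hx.trans_lt hz.1)
    simpa [gammaPDF] using this
  rw [this]
  simpa using hxy

/-- Tilting the density by exp(-tx) changes the rate from 1/2 to 1/2 + t, which is the same as a
dilation by 1/(1 + 2t). -/
lemma lintegral_halfGamma_exp_mul {p t : ℝ} (hp : 0 < p) (ht : -1 / 2 < t) {g : ℝ → ℝ≥0∞}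
    (hg : Measurable g) :
    ∫⁻ x, ENNReal.ofReal (Real.exp (-(t * x))) * g x ∂(halfGamma p) =
      ENNReal.ofReal ((1 + 2 * t) ^ (-p)) * ∫⁻ x, g (x / (1 + 2 * t)) ∂(halfGamma p) := by
  have hr : 0 < 1 + 2 * t := by linarith
  rw [lintegral_halfGamma _ (by fun_prop), lintegral_halfGamma _ (by fun_prop)]
  have hv := Real.smul_map_volume_mul_left hr.ne'
  conv_rhs => rw [← hv]
  rw [lintegral_smul_measure, lintegral_map (by have := measurable_gammaPDF p (1/2); fun_prop)
    (by fun_prop), smul_eq_mul, ← lintegral_const_mul _ (by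
      have := measurable_gammaPDF p (1/2); fun_prop), ← lintegral_const_mul _ (by
      have := measurable_gammaPDF p (1/2); fun_prop)]
  refine lintegral_congr_ae ((Measure.ae_ne volume (0 : ℝ)).mono fun x hx => ?_)
  simp only
  rw [mul_div_cancel_left₀ _ hr.ne', ← mul_assoc, ← mul_assoc, ← mul_assoc]
  congr 1
  rcases lt_or_gt_of_ne hx with hx | hx
  · rw [gammaPDF_of_neg hx, gammaPDF_of_neg (mul_neg_of_pos_of_neg hr hx)]; simp
  · have hG := Real.Gamma_pos_of_pos hp
    rw [gammaPDF_of_nonneg hx.le, gammaPDF_of_nonneg (by positivity), abs_of_pos hr,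
      ← ENNReal.ofReal_mul (by positivity), ← ENNReal.ofReal_mul (by positivity),
      ← ENNReal.ofReal_mul (by positivity)]
    congr 1
    rw [Real.mul_rpow hr.le hx.le, Real.rpow_sub_one hr.ne', Real.rpow_neg hr.le,
      mul_assoc (_ * _), ← Real.exp_add]
    have : (1 + 2 * t) ^ p ≠ 0 := (Real.rpow_pos_of_pos hr p).ne'
    have he : -(1 / 2 * ((1 + 2 * t) * x)) = -(1 / 2 * x) + -(t * x) := by ring
    rw [he]
    field_simp

lemma lintegral_halfGamma_exp {p t : ℝ} (hp : 0 < p) (ht : t < 1 / 2) :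
    ∫⁻ x, ENNReal.ofReal (Real.exp (t * x)) ∂(halfGamma p) =
      ENNReal.ofReal ((1 - 2 * t) ^ (-p)) := by
  have := isProbabilityMeasure_halfGamma hp
  have := lintegral_halfGamma_exp_mul hp (t := -t) (by linarith) (g := fun _ => 1) (by fun_prop)
  simpa [← sub_eq_add_neg] using this

lemma integrable_halfGamma_exp {p t : ℝ} (hp : 0 < p) (ht : t < 1 / 2) :
    Integrable (fun x => Real.exp (t * x)) (halfGamma p) := by
  refine ⟨by fun_prop, ?_⟩
  rw [hasFiniteIntegral_iff_ofReal (ae_of_all _ fun x => (Real.exp_pos _).le),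
    lintegral_halfGamma_exp hp ht]
  exact ENNReal.ofReal_lt_top

lemma mgf_halfGamma {p t : ℝ} (hp : 0 < p) (ht : t < 1 / 2) :
    mgf id (halfGamma p) t = (1 - 2 * t) ^ (-p) := by
  rw [mgf, integral_eq_lintegral_of_nonneg_ae (ae_of_all _ fun x => (Real.exp_pos _).le)
    (by simp only [id]; fun_prop)]
  simp only [id]
  rw [lintegral_halfGamma_exp hp ht, ENNReal.toReal_ofReal]
  have : 0 < 1 - 2 * t := by linarith
  positivity

lemma analyticOnNhd_complexMGF_halfGamma {p : ℝ} (hp : 0 < p) :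
    AnalyticOnNhd ℂ (complexMGF id (halfGamma p)) {z : ℂ | z.re < 1 / 2} := by
  refine analyticOnNhd_complexMGF.mono fun z hz => ?_
  have h : Iio (1 / 2 : ℝ) ⊆ integrableExpSet id (halfGamma p) := fun t ht =>
    integrable_halfGamma_exp hp ht
  exact interior_mono h (by simpa using hz)

/-- The moment generating functions multiply on the real half-line t < 1/2. The complex ones are
analytic on the half-plane Re z < 1/2, so the identity continues from the negative reals
accumulating at 0 to the imaginary axis, where it is one of characteristic functions. -/
lemma halfGamma_conv {p q : ℝ} (hp : 0 < p) (hq : 0 < q) :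
    ((halfGamma p).prod (halfGamma q)).map (fun x => x.1 + x.2) = halfGamma (p + q) := by
  have := isProbabilityMeasure_halfGamma hp
  have := isProbabilityMeasure_halfGamma hq
  have := isProbabilityMeasure_halfGamma (add_pos hp hq)
  change Measure.conv (halfGamma p) (halfGamma q) = _
  have key := ((analyticOnNhd_complexMGF_halfGamma hp).mul
    (analyticOnNhd_complexMGF_halfGamma hq)).eqOn_of_preconnected_of_frequently_eq
    (analyticOnNhd_complexMGF_halfGamma (add_pos hp hq)) (z₀ := 0)
    (convex_halfSpace_re_lt (1 / 2)).isPreconnected (by simp) (by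
      have hreal : ∀ t : ℝ, t < 1 / 2 → (complexMGF id (halfGamma p) *
          complexMGF id (halfGamma q)) (t : ℂ) = complexMGF id (halfGamma (p + q)) (t : ℂ) := by
        intro t ht
        have h0 : 0 < 1 - 2 * t := by linarith
        rw [Pi.mul_apply, complexMGF_ofReal, complexMGF_ofReal, complexMGF_ofReal,
          mgf_halfGamma hp ht, mgf_halfGamma hq ht, mgf_halfGamma (add_pos hp hq) ht, neg_add,
          Real.rpow_add h0]
        push_cast; rfl
      have hlim : Filter.Tendsto (fun t : ℝ => (t : ℂ)) (𝓝[<] 0) (𝓝[≠] 0) := by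
        refine tendsto_nhdsWithin_iff.2 ⟨?_, ?_⟩
        · exact (Complex.continuous_ofReal.tendsto' 0 0 (by simp)).mono_left nhdsWithin_le_nhds
        · filter_upwards [self_mem_nhdsWithin] with t ht
          simpa using ne_of_lt ht
      refine hlim.frequently (Filter.Eventually.frequently ?_)
      filter_upwards [self_mem_nhdsWithin] with t ht
      exact hreal t (lt_trans ht (by norm_num)))
  refine Measure.ext_of_charFun ?_
  ext t
  have := key (x := t * Complex.I) (by simp)
  simp only [complexMGF_id_mul_I] at this
  rw [charFun_conv, this]

/-- Size bias: the factor x raises the exponent in the density by one, and 2p is the mean. -/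
lemma lintegral_halfGamma_ofReal_mul {p : ℝ} (hp : 0 < p) {g : ℝ → ℝ≥0∞} (hg : Measurable g) :
    ∫⁻ x, ENNReal.ofReal x * g x ∂(halfGamma p) =
      ENNReal.ofReal (2 * p) * ∫⁻ x, g x ∂(halfGamma (p + 1)) := by
  rw [lintegral_halfGamma _ (by fun_prop), lintegral_halfGamma _ (by fun_prop),
    ← lintegral_const_mul _ (by have := measurable_gammaPDF (p+1) (1/2); fun_prop)]
  refine lintegral_congr_ae ((Measure.ae_ne volume (0 : ℝ)).mono fun x hx => ?_)
  simp only
  rw [← mul_assoc, ← mul_assoc]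
  congr 1
  rcases lt_or_gt_of_ne hx with hx | hx
  · rw [gammaPDF_of_neg hx, gammaPDF_of_neg hx]; simp
  · have hG := Real.Gamma_pos_of_pos hp
    have hG1 := Real.Gamma_pos_of_pos (by positivity : 0 < p + 1)
    rw [gammaPDF_of_nonneg hx.le, gammaPDF_of_nonneg hx.le,
      ← ENNReal.ofReal_mul (by positivity), ← ENNReal.ofReal_mul (by positivity)]
    congr 1
    rw [Real.Gamma_add_one hp.ne', add_sub_cancel_right, Real.rpow_sub_one hx.ne',
      Real.rpow_add_one (by norm_num)]
    field_simp

/-! ### Three Gamma variables and the Neyman–Pearson argument on cones -/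

/-- The joint law of three independent Gamma variables of rate `1 / 2`. -/
noncomputable def gammaTriple (p b c : ℝ) : Measure (ℝ × ℝ × ℝ) :=
  (halfGamma p).prod ((halfGamma b).prod (halfGamma c))

instance gammaTriple.instSFinite (p b c : ℝ) : SFinite (gammaTriple p b c) := by
  unfold gammaTriple; infer_instance

lemma isProbabilityMeasure_gammaTriple {p b c : ℝ} (hp : 0 < p) (hb : 0 < b) (hc : 0 < c) :
    IsProbabilityMeasure (gammaTriple p b c) := by
  have := isProbabilityMeasure_halfGamma hp
  have := isProbabilityMeasure_halfGamma hb
  have := isProbabilityMeasure_halfGamma hc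
  unfold gammaTriple; infer_instance

lemma ae_gammaTriple_pos (p b c : ℝ) :
    ∀ᵐ x ∂(gammaTriple p b c), 0 < x.1 ∧ 0 < x.2.1 ∧ 0 < x.2.2 := by
  unfold gammaTriple
  have h1 := Measure.quasiMeasurePreserving_fst (μ := halfGamma p)
    (ν := (halfGamma b).prod (halfGamma c)) |>.ae (ae_halfGamma_pos p)
  have h2 := Measure.quasiMeasurePreserving_fst (μ := halfGamma b)
    (ν := halfGamma c) |>.ae (ae_halfGamma_pos b)
  have h3 := Measure.quasiMeasurePreserving_snd (μ := halfGamma b)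
    (ν := halfGamma c) |>.ae (ae_halfGamma_pos c)
  have h4 := Measure.quasiMeasurePreserving_snd (μ := halfGamma p)
    (ν := (halfGamma b).prod (halfGamma c)) |>.ae (h2.and h3)
  filter_upwards [h1, h4] with x h1 h4 using ⟨h1, h4⟩

lemma withDensity_halfGamma_exp {p t : ℝ} (hp : 0 < p) (ht : -1 / 2 < t) :
    (halfGamma p).withDensity (fun x => ENNReal.ofReal (Real.exp (-(t * x)))) =
      ENNReal.ofReal ((1 + 2 * t) ^ (-p)) • (halfGamma p).map (fun x => x / (1 + 2 * t)) := by
  ext s hs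
  have hi : Measurable (s.indicator (1 : ℝ → ℝ≥0∞)) := measurable_one.indicator hs
  rw [withDensity_apply _ hs, Measure.smul_apply, ← lintegral_indicator_one hs,
    lintegral_map hi (by fun_prop), smul_eq_mul, ← lintegral_halfGamma_exp_mul hp ht hi,
    ← lintegral_indicator hs]
  refine lintegral_congr fun x => ?_
  by_cases hx : x ∈ s <;> simp [hx]

/-- Tilting all three coordinates by the same t is a common dilation, which a cone does not notice;
only the normalising constants remain. -/
lemma setLIntegral_gammaTriple_exp {p b c t : ℝ} (hp : 0 < p) (hb : 0 < b) (hc : 0 < c)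
    (ht : -1 / 2 < t) {E : Set (ℝ × ℝ × ℝ)} (hE : MeasurableSet E)
    (hcone : ∀ r : ℝ, 0 < r → ∀ x, r • x ∈ E ↔ x ∈ E) :
    ∫⁻ x in E, ENNReal.ofReal (Real.exp (-(t * (x.1 + x.2.1 + x.2.2)))) ∂(gammaTriple p b c) =
      ENNReal.ofReal ((1 + 2 * t) ^ (-p)) * ENNReal.ofReal ((1 + 2 * t) ^ (-b)) *
        ENNReal.ofReal ((1 + 2 * t) ^ (-c)) * gammaTriple p b c E := by
  have hr : 0 < 1 + 2 * t := by linarith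
  have hexp : Measurable fun x : ℝ => ENNReal.ofReal (Real.exp (-(t * x))) := by fun_prop
  have h : (gammaTriple p b c).withDensity
      (fun x => ENNReal.ofReal (Real.exp (-(t * (x.1 + x.2.1 + x.2.2))))) =
      (ENNReal.ofReal ((1 + 2 * t) ^ (-p)) * ENNReal.ofReal ((1 + 2 * t) ^ (-b)) *
        ENNReal.ofReal ((1 + 2 * t) ^ (-c))) • (gammaTriple p b c).map
          (fun x => (1 + 2 * t)⁻¹ • x) := by
    have h1 : (fun x : ℝ × ℝ × ℝ => ENNReal.ofReal (Real.exp (-(t * (x.1 + x.2.1 + x.2.2))))) =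
        fun x => ENNReal.ofReal (Real.exp (-(t * x.1))) *
          (fun y : ℝ × ℝ => ENNReal.ofReal (Real.exp (-(t * y.1))) *
            ENNReal.ofReal (Real.exp (-(t * y.2)))) x.2 := by
      funext x
      simp only
      rw [← ENNReal.ofReal_mul (Real.exp_pos _).le, ← ENNReal.ofReal_mul (Real.exp_pos _).le,
        ← Real.exp_add, ← Real.exp_add]
      congr 2; ring
    rw [h1, gammaTriple, ← prod_withDensity hexp (g := fun y : ℝ × ℝ =>
        ENNReal.ofReal (Real.exp (-(t * y.1))) * ENNReal.ofReal (Real.exp (-(t * y.2))))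
        (by fun_prop), ← prod_withDensity hexp hexp,
      withDensity_halfGamma_exp hp ht, withDensity_halfGamma_exp hb ht,
      withDensity_halfGamma_exp hc ht, Measure.prod_smul_left, Measure.prod_smul_right,
      Measure.prod_smul_left, Measure.prod_smul_right, Measure.map_prod_map _ _ (by fun_prop)
      (by fun_prop), Measure.prod_smul_right, Measure.map_prod_map _ _ (by fun_prop)
      (by fun_prop), smul_smul, smul_smul, mul_right_comm]
    congr 2
    funext x
    simp only [Prod.map, Prod.smul_def, smul_eq_mul, div_eq_inv_mul]
  rw [← withDensity_apply _ hE, h, Measure.smul_apply, Measure.map_apply (by fun_prop) hE,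
    smul_eq_mul]
  congr 2
  ext x
  exact hcone _ (inv_pos.2 hr) x

/-- The likelihood ratio of the shapes p + 1 and p on the scale-invariant sets. Write 1/s as the
integral of exp(-ts) over t > 0 with s the sum of the coordinates, absorb the factor x₁ as a size
bias, and use that the tilts factor through the measure of the cone. The point is that D does not
depend on E. -/
lemma setLIntegral_gammaTriple_ratio {p b c : ℝ} (hp : 0 < p) (hb : 0 < b) (hc : 0 < c) :
    ∃ D : ℝ≥0∞, ∀ E : Set (ℝ × ℝ × ℝ), MeasurableSet E →
      (∀ r : ℝ, 0 < r → ∀ x, r • x ∈ E ↔ x ∈ E) →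
      ∫⁻ x in E, ENNReal.ofReal (x.1 / (x.1 + x.2.1 + x.2.2)) ∂(gammaTriple p b c) =
        D * gammaTriple (p + 1) b c E := by
  refine ⟨ENNReal.ofReal (2 * p) * ∫⁻ t in Ioi (0 : ℝ), ENNReal.ofReal ((1 + 2 * t) ^ (-(p + 1))) *
    ENNReal.ofReal ((1 + 2 * t) ^ (-b)) * ENNReal.ofReal ((1 + 2 * t) ^ (-c)), fun E hE hcone => ?_⟩
  have hshift : ∀ f : ℝ × ℝ × ℝ → ℝ≥0∞, Measurable f →
      ∫⁻ x, ENNReal.ofReal x.1 * f x ∂(gammaTriple p b c) =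
        ENNReal.ofReal (2 * p) * ∫⁻ x, f x ∂(gammaTriple (p + 1) b c) := by
    intro f hf
    rw [gammaTriple, gammaTriple]
    have : SFinite ((halfGamma b).prod (halfGamma c)) := inferInstance
    generalize (halfGamma b).prod (halfGamma c) = ν at this
    rw [lintegral_prod_symm' _ (by fun_prop), lintegral_prod_symm' _ (by fun_prop),
      ← lintegral_const_mul _ hf.lintegral_prod_left']
    exact lintegral_congr fun y => lintegral_halfGamma_ofReal_mul hp (by fun_prop)
  have hind : Measurable (E.indicator (1 : ℝ × ℝ × ℝ → ℝ≥0∞)) := measurable_one.indicator hE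
  calc ∫⁻ x in E, ENNReal.ofReal (x.1 / (x.1 + x.2.1 + x.2.2)) ∂(gammaTriple p b c)
      = ∫⁻ x, ENNReal.ofReal x.1 * (E.indicator 1 x * ENNReal.ofReal (1 / (x.1 + x.2.1 + x.2.2)))
          ∂(gammaTriple p b c) := by
        rw [← lintegral_indicator hE]
        refine lintegral_congr_ae ((ae_gammaTriple_pos p b c).mono fun x hx => ?_)
        by_cases hxE : x ∈ E
        · simp only [hxE, indicator_of_mem, Pi.one_apply, one_mul]
          rw [← ENNReal.ofReal_mul hx.1.le, mul_one_div]
        · simp [hxE]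
    _ = ENNReal.ofReal (2 * p) * ∫⁻ x, E.indicator 1 x *
          ENNReal.ofReal (1 / (x.1 + x.2.1 + x.2.2)) ∂(gammaTriple (p + 1) b c) :=
        hshift _ (by fun_prop)
    _ = ENNReal.ofReal (2 * p) * ∫⁻ x : ℝ × ℝ × ℝ, (∫⁻ t in Ioi (0 : ℝ), E.indicator 1 x *
          ENNReal.ofReal (Real.exp (-(t * (x.1 + x.2.1 + x.2.2))))) ∂(gammaTriple (p + 1) b c) := by
        congr 1
        refine lintegral_congr_ae ((ae_gammaTriple_pos _ b c).mono fun x hx => ?_)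
        have hs : 0 < x.1 + x.2.1 + x.2.2 := by linarith [hx.1, hx.2.1, hx.2.2]
        simp only
        rw [lintegral_const_mul _ (by fun_prop)]
        congr 1
        rw [← ofReal_integral_eq_lintegral_ofReal]
        · congr 1
          have h2 := Real.integral_rpow_mul_exp_neg_mul_Ioi (a := 1) one_pos hs
          simp only [sub_self, Real.rpow_zero, one_mul, Real.rpow_one, Real.Gamma_one,
            mul_one] at h2
          rw [← h2]
          refine integral_congr_ae (ae_of_all _ fun t => ?_)
          simp only [mul_comm]
        · have := exp_neg_integrableOn_Ioi 0 hs
          refine this.congr (ae_of_all _ fun t => ?_)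
          simp only; congr 1; ring
        · exact ae_of_all _ fun t => (Real.exp_pos _).le
    _ = ENNReal.ofReal (2 * p) * ∫⁻ t in Ioi (0 : ℝ), ∫⁻ x, E.indicator 1 x *
          ENNReal.ofReal (Real.exp (-(t * (x.1 + x.2.1 + x.2.2)))) ∂(gammaTriple (p + 1) b c) := by
        rw [lintegral_lintegral_swap]
        exact Measurable.aemeasurable (by fun_prop)
    _ = _ := by
        rw [mul_assoc, ← lintegral_mul_const _ (by fun_prop)]
        congr 1
        refine setLIntegral_congr_fun measurableSet_Ioi fun t ht => ?_
        have ht : (0 : ℝ) < t := ht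
        rw [← setLIntegral_gammaTriple_exp (by linarith) hb hc (by linarith) hE hcone,
          ← lintegral_indicator hE]
        refine lintegral_congr fun x => ?_
        by_cases hxE : x ∈ E <;> simp [hxE]

/-- A Neyman–Pearson argument: among the tests given by cones `B`, those of the form
`x₁ > k (x₂ + x₃)` are the most powerful ones when the shape of `x₁` increases by one. -/
lemma gammaTriple_cone_lt {p b c k : ℝ} (hp : 0 < p) (hb : 0 < b) (hc : 0 < c) (hk : 0 < k)
    {B : Set (ℝ × ℝ × ℝ)} (hB : MeasurableSet B)
    (hcone : ∀ r : ℝ, 0 < r → ∀ x, r • x ∈ B ↔ x ∈ B) {l₁ u₁ l₂ u₂ l₃ u₃ : ℝ}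
    (h₁ : 0 ≤ l₁) (h₁' : l₁ < u₁) (h₂ : 0 ≤ l₂) (h₂' : l₂ < u₂) (h₃ : 0 ≤ l₃) (h₃' : l₃ < u₃)
    (hbox : Ioo l₁ u₁ ×ˢ Ioo l₂ u₂ ×ˢ Ioo l₃ u₃ ⊆ B) (hout : u₁ ≤ k * (l₂ + l₃))
    (hle : (gammaTriple p b c).real B ≤
      (gammaTriple p b c).real {x | k * (x.2.1 + x.2.2) < x.1}) :
    (gammaTriple (p + 1) b c).real B <
      (gammaTriple (p + 1) b c).real {x | k * (x.2.1 + x.2.2) < x.1} := by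
  have := isProbabilityMeasure_gammaTriple hp hb hc
  set μ := gammaTriple p b c with hμ
  set A : Set (ℝ × ℝ × ℝ) := {x | k * (x.2.1 + x.2.2) < x.1} with hA
  have hAm : MeasurableSet A := measurableSet_lt (by fun_prop) (by fun_prop)
  have hAcone : ∀ r : ℝ, 0 < r → ∀ x, r • x ∈ A ↔ x ∈ A := by
    intro r hr x
    simp only [hA, mem_ofPred_eq, Prod.smul_fst, Prod.smul_snd, smul_eq_mul, ← mul_add]
    rw [mul_left_comm, mul_lt_mul_iff_right₀ hr]
  obtain ⟨D, hD⟩ := setLIntegral_gammaTriple_ratio hp hb hc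
  set w : ℝ × ℝ × ℝ → ℝ := fun x => x.1 / (x.1 + x.2.1 + x.2.2) with hw
  have hwm : Measurable w := by fun_prop
  have hw01 : ∀ᵐ x ∂μ, 0 ≤ w x ∧ w x ≤ 1 := by
    filter_upwards [ae_gammaTriple_pos p b c] with x hx
    obtain ⟨hx1, hx2, hx3⟩ := hx
    exact ⟨by positivity, by rw [hw]; exact div_le_one_of_le₀ (by linarith) (by positivity)⟩
  have hwint : Integrable w μ := Integrable.of_bound hwm.aestronglyMeasurable 1
    (hw01.mono fun x hx => by rw [Real.norm_eq_abs, abs_of_nonneg hx.1]; exact hx.2)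
  have hset : ∀ E, MeasurableSet E → (∀ r : ℝ, 0 < r → ∀ x, r • x ∈ E ↔ x ∈ E) →
      ∫ x in E, w x ∂μ = D.toReal * (gammaTriple (p + 1) b c).real E := by
    intro E hE hEc
    rw [integral_eq_lintegral_of_nonneg_ae (ae_restrict_of_ae (hw01.mono fun x hx => hx.1))
      hwm.aestronglyMeasurable, hD E hE hEc, ENNReal.toReal_mul]
    rfl
  -- The threshold of the weight: x₁ > k(x₂ + x₃) is equivalent to x₁/(x₁ + x₂ + x₃) > k/(1 + k).
  set w₀ : ℝ := k / (1 + k) with hw₀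
  have hw₀pos : 0 < w₀ := by positivity
  have hwA : ∀ x : ℝ × ℝ × ℝ, (0 < x.1 ∧ 0 < x.2.1 ∧ 0 < x.2.2) → (w₀ < w x ↔ x ∈ A) := by
    intro x ⟨hx1, hx2, hx3⟩
    simp only [hw, hw₀, hA, mem_ofPred_eq]
    rw [div_lt_div_iff₀ (by positivity) (by positivity)]
    constructor <;> intro h <;> nlinarith
  -- The Neyman–Pearson integrand: both factors have the same sign wherever the first is nonzero,
  -- because A is the set where the weight exceeds w₀.
  set f : ℝ × ℝ × ℝ → ℝ := fun x => (A.indicator 1 x - B.indicator 1 x) * (w x - w₀) with hf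
  have e : f = (A.indicator w - B.indicator w) -
      fun x => w₀ * (A.indicator (1 : ℝ × ℝ × ℝ → ℝ) - B.indicator (1 : ℝ × ℝ × ℝ → ℝ)) x := by
    funext x
    by_cases hxA : x ∈ A <;> by_cases hxB : x ∈ B <;> simp [hf, hxA, hxB, neg_add_eq_sub]
  have iA : Integrable (A.indicator (1 : ℝ × ℝ × ℝ → ℝ)) μ := (integrable_const 1).indicator hAm
  have iB : Integrable (B.indicator (1 : ℝ × ℝ × ℝ → ℝ)) μ := (integrable_const 1).indicator hB
  have hfint : Integrable f μ := by
    rw [e]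
    exact ((hwint.indicator hAm).sub (hwint.indicator hB)).sub ((iA.sub iB).const_mul _)
  have hf0 : 0 ≤ᵐ[μ] f := by
    filter_upwards [ae_gammaTriple_pos p b c] with x hx
    have := hwA x hx
    by_cases hxA : x ∈ A
    · have h1 := this.2 hxA
      by_cases hxB : x ∈ B <;> simp [hf, hxA, hxB, h1.le]
    · have h1 : w x ≤ w₀ := not_lt.1 fun h => hxA (this.1 h)
      by_cases hxB : x ∈ B <;> simp [hf, hxA, hxB, h1]
  -- Strictness comes from the box: it has positive measure and lies in B, and `hout` keeps it on
  -- the side where the weight is strictly below w₀.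
  have hfpos : 0 < ∫ x, f x ∂μ := by
    rw [integral_pos_iff_support_of_nonneg_ae hf0 hfint]
    refine lt_of_lt_of_le ?_ (measure_mono
      (s := Ioo l₁ u₁ ×ˢ Ioo l₂ u₂ ×ˢ Ioo l₃ u₃) fun x hx => ?_)
    · rw [hμ, gammaTriple, Measure.prod_prod, Measure.prod_prod]
      exact ENNReal.mul_pos (halfGamma_Ioo_pos hp h₁ h₁').ne' (ENNReal.mul_pos
        (halfGamma_Ioo_pos hb h₂ h₂').ne' (halfGamma_Ioo_pos hc h₃ h₃').ne').ne'
    · have hxB := hbox hx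
      obtain ⟨hx1, hx2, hx3⟩ := hx
      have hlt : x.1 < k * (x.2.1 + x.2.2) := hx1.2.trans_le (hout.trans
        (by nlinarith [hx2.1, hx3.1]))
      have hxA : x ∉ A := fun h => lt_asymm h hlt
      have p1 : 0 < x.1 := h₁.trans_lt hx1.1
      have p2 : 0 < x.2.1 := h₂.trans_lt hx2.1
      have p3 : 0 < x.2.2 := h₃.trans_lt hx3.1
      have : w x < w₀ := by
        simp only [hw, hw₀]
        rw [div_lt_div_iff₀ (by positivity) (by positivity)]
        nlinarith
      simp [hf, hxA, hxB, sub_eq_zero, this.ne]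
  have hcalc : ∫ x, f x ∂μ = D.toReal * ((gammaTriple (p + 1) b c).real A -
      (gammaTriple (p + 1) b c).real B) - w₀ * (μ.real A - μ.real B) := by
    rw [e, integral_sub' ((hwint.indicator hAm).sub (hwint.indicator hB))
      ((iA.sub iB).const_mul _), integral_sub' (hwint.indicator hAm) (hwint.indicator hB),
      integral_const_mul, integral_sub' iA iB, integral_indicator hAm, integral_indicator hB,
      integral_indicator_one hAm, integral_indicator_one hB, hset A hAm hAcone,
      hset B hB hcone]
    ring
  have : 0 < D.toReal * ((gammaTriple (p + 1) b c).real A -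
      (gammaTriple (p + 1) b c).real B) := by
    nlinarith [mul_nonneg hw₀pos.le (sub_nonneg.2 hle)]
  exact sub_pos.1 (pos_of_mul_pos_right this ENNReal.toReal_nonneg)

/-! ### Tail probabilities of the ratio of two Gamma variables -/

/-- The probability that `X₁ > k X₂` for independent Gamma variables of shapes `p` and `b` and
equal rates. -/
noncomputable def ratioTail (p b k : ℝ) : ℝ :=
  ((halfGamma p).prod (halfGamma b)).real {x | k * x.2 < x.1}

lemma ratioTail_nonneg (p b k : ℝ) : 0 ≤ ratioTail p b k := measureReal_nonneg

lemma ratioTail_le_one {p b : ℝ} (hp : 0 < p) (hb : 0 < b) (k : ℝ) : ratioTail p b k ≤ 1 := by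
  have := isProbabilityMeasure_halfGamma hp
  have := isProbabilityMeasure_halfGamma hb
  exact measureReal_le_one

lemma measurable_halfGamma_real_Ioi {p : ℝ} (hp : 0 < p) (k : ℝ) :
    Measurable fun y => (halfGamma p).real (Ioi (k * y)) := by
  have := isProbabilityMeasure_halfGamma hp
  have h : Antitone fun t => (halfGamma p).real (Ioi t) := fun s t hst =>
    measureReal_mono (Ioi_subset_Ioi hst)
  exact h.measurable.comp (by fun_prop : Measurable fun y : ℝ => k * y)

lemma ratioTail_eq_integral {p : ℝ} (hp : 0 < p) (b k : ℝ) :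
    ratioTail p b k = ∫ y, (halfGamma p).real (Ioi (k * y)) ∂(halfGamma b) := by
  have := isProbabilityMeasure_halfGamma hp
  rw [ratioTail, measureReal_def, Measure.prod_apply_symm
    (measurableSet_lt (by fun_prop) (by fun_prop)), integral_eq_lintegral_of_nonneg_ae
    (ae_of_all _ fun _ => measureReal_nonneg)
    (measurable_halfGamma_real_Ioi hp k).aestronglyMeasurable]
  congr 1
  refine lintegral_congr fun y => ?_
  rw [ofReal_measureReal]
  rfl

lemma integrable_halfGamma_real_Ioi {p b : ℝ} (hp : 0 < p) (hb : 0 < b) (k : ℝ) :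
    Integrable (fun y => (halfGamma p).real (Ioi (k * y))) (halfGamma b) := by
  have := isProbabilityMeasure_halfGamma hp
  have := isProbabilityMeasure_halfGamma hb
  refine Integrable.of_bound (measurable_halfGamma_real_Ioi hp k).aestronglyMeasurable 1
    (ae_of_all _ fun y => ?_)
  rw [Real.norm_eq_abs, abs_of_nonneg measureReal_nonneg]
  exact measureReal_le_one

lemma ratioTail_of_nonpos {p b k : ℝ} (hp : 0 < p) (hb : 0 < b) (hk : k ≤ 0) :
    ratioTail p b k = 1 := by
  have := isProbabilityMeasure_halfGamma hp
  have := isProbabilityMeasure_halfGamma hb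
  have h0 : (halfGamma p).real (Ioi 0) = 1 := by
    rw [measureReal_def, (mem_ae_iff_prob_eq_one measurableSet_Ioi).1 (ae_halfGamma_pos p),
      ENNReal.toReal_one]
  rw [ratioTail_eq_integral hp, integral_congr_ae (g := fun _ => 1)
    ((ae_halfGamma_pos b).mono fun y hy => ?_)]
  · simp
  · refine le_antisymm measureReal_le_one (h0.symm.le.trans (measureReal_mono ?_))
    exact Ioi_subset_Ioi (mul_nonpos_of_nonpos_of_nonneg hk hy.le)

lemma strictAntiOn_ratioTail {p b : ℝ} (hp : 0 < p) (hb : 0 < b) :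
    StrictAntiOn (ratioTail p b) (Ici 0) := by
  have := isProbabilityMeasure_halfGamma hp
  have := isProbabilityMeasure_halfGamma hb
  intro k hk l _ hkl
  have hk : 0 ≤ k := hk
  rw [ratioTail_eq_integral hp, ratioTail_eq_integral hp, ← sub_pos, ← integral_sub
    (integrable_halfGamma_real_Ioi hp hb k) (integrable_halfGamma_real_Ioi hp hb l)]
  have key : ∀ y, 0 < y → 0 < (halfGamma p).real (Ioi (k * y)) - (halfGamma p).real (Ioi (l * y)) := by
    intro y hy
    have hlt : k * y < l * y := mul_lt_mul_of_pos_right hkl hy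
    rw [← measureReal_sdiff (Ioi_subset_Ioi hlt.le) measurableSet_Ioi]
    refine ENNReal.toReal_pos (ne_of_gt ?_) (measure_ne_top _ _)
    refine (halfGamma_Ioo_pos hp (by positivity) hlt).trans_le (measure_mono ?_)
    intro x hx
    exact ⟨hx.1, not_lt.2 hx.2.le⟩
  rw [integral_pos_iff_support_of_nonneg_ae ((ae_halfGamma_pos b).mono fun y hy => (key y hy).le)
    ((integrable_halfGamma_real_Ioi hp hb k).sub (integrable_halfGamma_real_Ioi hp hb l))]
  refine (halfGamma_Ioo_pos hb le_rfl one_pos).trans_le (measure_mono fun y hy => ?_)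
  exact (key y hy.1).ne'

lemma continuous_halfGamma_real_Ioi {p : ℝ} (hp : 0 < p) :
    Continuous fun t => (halfGamma p).real (Ioi t) := by
  have := isProbabilityMeasure_halfGamma hp
  have h : ∀ t, (halfGamma p).real (Ioi t) = ∫ x, (Ioi t).indicator 1 x ∂(halfGamma p) :=
    fun t => (integral_indicator_one measurableSet_Ioi).symm
  simp_rw [h]
  refine continuous_iff_continuousAt.2 fun t => ?_
  refine continuousAt_of_dominated (bound := fun _ => 1) ?_ ?_ (integrable_const 1) ?_
  · exact Filter.Eventually.of_forall fun s =>
      (measurable_one.indicator measurableSet_Ioi).aestronglyMeasurable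
  · refine Filter.Eventually.of_forall fun s => ae_of_all _ fun x => ?_
    by_cases hx : x ∈ Ioi s <;> simp [hx]
  · refine (Measure.ae_ne (halfGamma p) t).mono fun x hx => ?_
    rcases lt_or_gt_of_ne hx with hx | hx
    · refine continuousAt_const (y := (0 : ℝ)) |>.congr ?_
      filter_upwards [lt_mem_nhds hx] with s hs
      simp [hs.le]
    · refine continuousAt_const (y := (1 : ℝ)) |>.congr ?_
      filter_upwards [gt_mem_nhds hx] with s hs
      simp [hs]

lemma continuous_ratioTail {p b : ℝ} (hp : 0 < p) (hb : 0 < b) : Continuous (ratioTail p b) := by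
  have := isProbabilityMeasure_halfGamma hp
  have := isProbabilityMeasure_halfGamma hb
  rw [funext (ratioTail_eq_integral hp b)]
  refine continuous_of_dominated (bound := fun _ => 1)
    (fun k => (measurable_halfGamma_real_Ioi hp k).aestronglyMeasurable)
    (fun k => ae_of_all _ fun y => ?_) (integrable_const 1) (ae_of_all _ fun y => ?_)
  · rw [Real.norm_eq_abs, abs_of_nonneg measureReal_nonneg]
    exact measureReal_le_one
  · exact (continuous_halfGamma_real_Ioi hp).comp (continuous_id.mul continuous_const)

lemma tendsto_ratioTail_atTop {p b : ℝ} (hp : 0 < p) (hb : 0 < b) :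
    Filter.Tendsto (ratioTail p b) Filter.atTop (𝓝 0) := by
  have := isProbabilityMeasure_halfGamma hp
  have := isProbabilityMeasure_halfGamma hb
  rw [funext (ratioTail_eq_integral hp b)]
  have := tendsto_integral_filter_of_dominated_convergence (μ := halfGamma b)
    (l := (Filter.atTop : Filter ℝ)) (F := fun k y => (halfGamma p).real (Ioi (k * y)))
    (f := fun _ => 0) (fun _ => 1)
    (Filter.Eventually.of_forall fun k => (measurable_halfGamma_real_Ioi hp k).aestronglyMeasurable)
    (Filter.Eventually.of_forall fun k => ae_of_all _ fun y => by
      rw [Real.norm_eq_abs, abs_of_nonneg measureReal_nonneg]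
      exact measureReal_le_one) (integrable_const 1) ((ae_halfGamma_pos b).mono fun y hy => by
        have h := tendsto_const_nhds (x := (1 : ℝ)).sub (tendsto_cdf_atTop (halfGamma p))
        rw [sub_self] at h
        refine (h.comp (Filter.tendsto_id.atTop_mul_const hy)).congr fun k => ?_
        simp only [Function.comp_apply, id, cdf_eq_real]
        rw [← probReal_compl_eq_one_sub measurableSet_Iic, compl_Iic])
  simpa using this

lemma gammaTriple_real_add_right {p b c : ℝ} (hp : 0 < p) (hb : 0 < b) (hc : 0 < c) (k : ℝ) :
    (gammaTriple p b c).real {x | k * (x.2.1 + x.2.2) < x.1} = ratioTail p (b + c) k := by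
  have := isProbabilityMeasure_halfGamma hp
  have h : MeasurePreserving (fun x : ℝ × ℝ => x.1 + x.2) ((halfGamma b).prod (halfGamma c))
    (halfGamma (b + c)) := ⟨by fun_prop, halfGamma_conv hb hc⟩
  have h2 := (MeasurePreserving.id (halfGamma p)).prod h
  rw [ratioTail, gammaTriple, ← h2.measureReal_preimage
    (measurableSet_lt (by fun_prop) (by fun_prop)).nullMeasurableSet]
  rfl

lemma gammaTriple_real_fst {p b c : ℝ} (hp : 0 < p) (hb : 0 < b) (hc : 0 < c) (k : ℝ) :
    (gammaTriple p b c).real {x | k * x.2.1 < x.1} = ratioTail p b k := by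
  have := isProbabilityMeasure_halfGamma hp
  have := isProbabilityMeasure_halfGamma hb
  have := isProbabilityMeasure_halfGamma hc
  have h : MeasurePreserving (Prod.fst : ℝ × ℝ → ℝ) ((halfGamma b).prod (halfGamma c))
    (halfGamma b) := measurePreserving_fst
  have h2 := (MeasurePreserving.id (halfGamma p)).prod h
  rw [ratioTail, gammaTriple, ← h2.measureReal_preimage
    (measurableSet_lt (by fun_prop) (by fun_prop)).nullMeasurableSet]
  rfl

/-- The third coordinate is carried next to the first by a swap and a reassociation, both measure
preserving, and then added to it. -/
lemma gammaTriple_real_add_left {p b c : ℝ} (hp : 0 < p) (hb : 0 < b) (hc : 0 < c) (k : ℝ) :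
    (gammaTriple p b c).real {x | k * x.2.1 < x.1 + x.2.2} = ratioTail (p + c) b k := by
  have := isProbabilityMeasure_halfGamma hp
  have := isProbabilityMeasure_halfGamma hb
  have := isProbabilityMeasure_halfGamma hc
  have h : MeasurePreserving (fun x : ℝ × ℝ => x.1 + x.2) ((halfGamma p).prod (halfGamma c))
    (halfGamma (p + c)) := ⟨by fun_prop, halfGamma_conv hp hc⟩
  have h2 := h.prod (MeasurePreserving.id (halfGamma b))
  have h3 := (measurePreserving_prodAssoc (halfGamma p) (halfGamma c) (halfGamma b)).symm
  have h4 := (MeasurePreserving.id (halfGamma p)).prod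
    (Measure.measurePreserving_swap (μ := halfGamma b) (ν := halfGamma c))
  have h5 := (h2.comp h3).comp h4
  rw [ratioTail, gammaTriple, ← h5.measureReal_preimage
    (measurableSet_lt (by fun_prop) (by fun_prop)).nullMeasurableSet]
  rfl

lemma ratioTail_le_add_left {p b c : ℝ} (hp : 0 < p) (hb : 0 < b) (hc : 0 < c) (k : ℝ) :
    ratioTail p b k ≤ ratioTail (p + c) b k := by
  have := isProbabilityMeasure_gammaTriple hp hb hc
  rw [← gammaTriple_real_fst hp hb hc, ← gammaTriple_real_add_left hp hb hc]
  refine ENNReal.toReal_mono (measure_ne_top _ _) (measure_mono_ae ?_)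
  filter_upwards [ae_gammaTriple_pos p b c] with x hx h
  have h : k * x.2.1 < x.1 := h
  exact h.trans (by linarith [hx.2.2])

/-- The induction step for added denominator shape: the smaller model ignores the third variable, so
its region is a competing cone for the test based on the whole triple. -/
lemma ratioTail_add_one_lt_of_add_right {p b c k l : ℝ} (hp : 0 < p) (hb : 0 < b) (hc : 0 < c)
    (hk : 0 < k) (hl : 0 < l) (h : ratioTail p b k ≤ ratioTail p (b + c) l) :
    ratioTail (p + 1) b k < ratioTail (p + 1) (b + c) l := by
  have hp1 : 0 < p + 1 := by linarith
  rw [← gammaTriple_real_fst hp hb hc, ← gammaTriple_real_add_right hp hb hc] at h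
  rw [← gammaTriple_real_fst hp1 hb hc, ← gammaTriple_real_add_right hp1 hb hc]
  refine gammaTriple_cone_lt hp hb hc hl (measurableSet_lt (by fun_prop) (by fun_prop)) ?_
    -- On this box k x₂ < k < x₁, so the competing test rejects, while l(x₂ + x₃) > k + 2 > x₁, so
    -- the favoured test does not.
    (l₁ := k + 1) (u₁ := k + 2) (l₂ := 0) (u₂ := 1) (l₃ := (k + 2) / l) (u₃ := (k + 2) / l + 1)
    (by positivity) (by linarith) (by positivity) (by linarith) (by positivity) (by linarith)
    ?_ ?_ h
  · intro r hr x
    simp only [mem_ofPred_eq, Prod.smul_fst, Prod.smul_snd, smul_eq_mul]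
    rw [mul_left_comm, mul_lt_mul_iff_right₀ hr]
  · rintro x ⟨hx1, hx2, -⟩
    have := mul_lt_mul_of_pos_left hx2.2 hk
    simp only [mem_ofPred_eq]
    linarith [hx1.1]
  · rw [zero_add, mul_div_cancel₀ _ hl.ne']

/-- The induction step for shape c moved from numerator to denominator: the third variable is added
to the first in one test and to the second in the other. The box of the previous lemma still
separates the two regions. -/
lemma ratioTail_add_one_lt_of_transfer {p b c k l : ℝ} (hp : 0 < p) (hb : 0 < b) (hc : 0 < c)
    (hk : 0 < k) (hl : 0 < l) (h : ratioTail (p + c) b k ≤ ratioTail p (b + c) l) :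
    ratioTail (p + 1 + c) b k < ratioTail (p + 1) (b + c) l := by
  have hp1 : 0 < p + 1 := by linarith
  rw [← gammaTriple_real_add_left hp hb hc, ← gammaTriple_real_add_right hp hb hc] at h
  rw [← gammaTriple_real_add_left hp1 hb hc, ← gammaTriple_real_add_right hp1 hb hc]
  refine gammaTriple_cone_lt hp hb hc hl (measurableSet_lt (by fun_prop) (by fun_prop)) ?_
    (l₁ := k + 1) (u₁ := k + 2) (l₂ := 0) (u₂ := 1) (l₃ := (k + 2) / l) (u₃ := (k + 2) / l + 1)
    (by positivity) (by linarith) (by positivity) (by linarith) (by positivity) (by linarith)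
    ?_ ?_ h
  · intro r hr x
    simp only [mem_ofPred_eq, Prod.smul_fst, Prod.smul_snd, smul_eq_mul, ← mul_add]
    rw [mul_left_comm, mul_lt_mul_iff_right₀ hr]
  · rintro x ⟨hx1, hx2, hx3⟩
    have := mul_lt_mul_of_pos_left hx2.2 hk
    have : 0 < (k + 2) / l := by positivity
    simp only [mem_ofPred_eq]
    linarith [hx1.1, hx3.1]
  · rw [zero_add, mul_div_cancel₀ _ hl.ne']

/-! ### Continuity in the denominator shape -/

lemma integrable_gammaPDFReal {p r : ℝ} (hp : 0 < p) (hr : 0 < r) :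
    Integrable (gammaPDFReal p r) := by
  refine ⟨(measurable_gammaPDFReal p r).aestronglyMeasurable, ?_⟩
  rw [hasFiniteIntegral_iff_ofReal (ae_of_all _ fun x => gammaPDFReal_nonneg hp hr x)]
  change ∫⁻ x, gammaPDF p r x < ⊤
  rw [lintegral_gammaPDF_eq_one hp hr]
  exact ENNReal.one_lt_top

lemma integral_halfGamma {b : ℝ} (hb : 0 < b) (g : ℝ → ℝ) :
    ∫ y, g y ∂(halfGamma b) = ∫ y, gammaPDFReal b (1 / 2) y * g y := by
  rw [halfGamma, gammaMeasure, integral_withDensity_eq_integral_toReal_smul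
    (measurable_gammaPDF _ _) (ae_of_all _ fun _ => by simp [gammaPDF])]
  refine integral_congr_ae (ae_of_all _ fun y => ?_)
  simp only [gammaPDF, smul_eq_mul]
  rw [ENNReal.toReal_ofReal (gammaPDFReal_nonneg hb (by norm_num) y)]

lemma continuousAt_ratioTail_right {p b : ℝ} (hp : 0 < p) (hb : 0 < b) (k : ℝ) :
    ContinuousAt (fun b => ratioTail p b k) b := by
  have := isProbabilityMeasure_halfGamma hp
  set C : ℝ → ℝ := fun s => (1 / 2 : ℝ) ^ s / Real.Gamma s with hC
  have hCpos : ∀ s, 0 < s → 0 < C s := fun s hs =>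
    div_pos (by positivity) (Real.Gamma_pos_of_pos hs)
  have hCc : ContinuousAt C b := by
    refine ContinuousAt.div ?_ ?_ (Real.Gamma_pos_of_pos hb).ne'
    · exact (Real.continuous_const_rpow (by norm_num)).continuousAt
    · refine (Real.differentiableAt_Gamma fun m hm => ?_).continuousAt
      have : (0 : ℝ) ≤ m := m.cast_nonneg
      linarith
  have hev : (fun s => ratioTail p s k) =ᶠ[𝓝 b]
      fun s => ∫ y, gammaPDFReal s (1 / 2) y * (halfGamma p).real (Ioi (k * y)) := by
    filter_upwards [lt_mem_nhds hb] with s hs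
    rw [ratioTail_eq_integral hp, integral_halfGamma hs]
  refine ContinuousAt.congr ?_ hev.symm
  have hb2 : 0 < b / 2 := by positivity
  have h2b : 0 < 2 * b := by positivity
  -- For b/2 < s < 2b the power y ^ (s - 1) is at most y ^ (b/2 - 1) + y ^ (2b - 1), the first term
  -- serving y ≤ 1 and the second y ≥ 1. The factors (C q)⁻¹ strip the normalising constants of
  -- these two densities, and C s stays below C b + 1 near b.
  refine continuousAt_of_dominated (bound := fun y => (C b + 1) * ((C (b / 2))⁻¹ *
      gammaPDFReal (b / 2) (1 / 2) y + (C (2 * b))⁻¹ * gammaPDFReal (2 * b) (1 / 2) y)) ?_ ?_ ?_ ?_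
  · exact Filter.Eventually.of_forall fun s => ((measurable_gammaPDFReal _ _).mul
      (measurable_halfGamma_real_Ioi hp k)).aestronglyMeasurable
  · filter_upwards [lt_mem_nhds (show b / 2 < b by linarith),
      gt_mem_nhds (show b < 2 * b by linarith), hCc.eventually_lt continuousAt_const
      (show C b < C b + 1 by linarith)] with s hs1 hs2 hs3
    have hs : 0 < s := hb2.trans hs1
    refine (Measure.ae_ne volume (0 : ℝ)).mono fun y hy0 => ?_
    have hnn := gammaPDFReal_nonneg hs (r := 1 / 2) (by norm_num) y
    rw [norm_mul, Real.norm_of_nonneg hnn, Real.norm_of_nonneg measureReal_nonneg]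
    refine (mul_le_of_le_one_right hnn measureReal_le_one).trans ?_
    have key : ∀ q, 0 < q → 0 < y →
        (C q)⁻¹ * gammaPDFReal q (1 / 2) y = y ^ (q - 1) * Real.exp (-(1 / 2 * y)) := by
      intro q hq hy
      rw [gammaPDFReal, if_pos hy.le, mul_assoc, inv_mul_cancel_left₀ (hCpos q hq).ne']
    rcases lt_or_gt_of_ne hy0 with hy | hy
    · simp [gammaPDFReal, not_le.2 hy]
    · rw [key _ hb2 hy, key _ h2b hy, ← add_mul, gammaPDFReal, if_pos hy.le, mul_assoc]
      refine mul_le_mul hs3.le (mul_le_mul_of_nonneg_right ?_ (Real.exp_pos _).le)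
        (by positivity) (by linarith [hCpos b hb])
      rcases le_total y 1 with h1 | h1
      · have := Real.rpow_le_rpow_of_exponent_ge hy h1 (show b / 2 - 1 ≤ s - 1 by linarith)
        have h0 : 0 ≤ y ^ (2 * b - 1) := by positivity
        linarith
      · have := Real.rpow_le_rpow_of_exponent_le h1 (show s - 1 ≤ 2 * b - 1 by linarith)
        have h0 : 0 ≤ y ^ (b / 2 - 1) := by positivity
        linarith
  · exact (((integrable_gammaPDFReal hb2 (by norm_num)).const_mul _).add
      ((integrable_gammaPDFReal h2b (by norm_num)).const_mul _)).const_mul _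
  · refine (Measure.ae_ne volume (0 : ℝ)).mono fun y hy => ?_
    refine ContinuousAt.mul ?_ continuousAt_const
    rcases lt_or_gt_of_ne hy with hy | hy
    · simp only [gammaPDFReal, if_neg (not_le.2 hy)]
      exact continuousAt_const
    · simp only [gammaPDFReal, if_pos hy.le]
      refine ContinuousAt.mul (hCc.mul ?_) continuousAt_const
      exact ((Real.continuous_const_rpow hy.ne').comp
        (continuous_id.sub continuous_const)).continuousAt

/-! ### Critical values and conditional power -/

/-- The critical value of the ratio of two Gamma variables at level `α`. -/
noncomputable def critRatio (α a b : ℝ) : ℝ :=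
  Classical.epsilon fun k => 0 < k ∧ ratioTail a b k = α

lemma critRatio_spec {α a b : ℝ} (hα : α ∈ Ioo (0 : ℝ) 1) (ha : 0 < a) (hb : 0 < b) :
    0 < critRatio α a b ∧ ratioTail a b (critRatio α a b) = α := by
  refine Classical.epsilon_spec (p := fun k => 0 < k ∧ ratioTail a b k = α) ?_
  obtain ⟨k, hk⟩ := ((tendsto_ratioTail_atTop ha hb).eventually_lt_const hα.1).exists
  obtain ⟨l, hl⟩ := mem_range_of_exists_le_of_exists_ge (continuous_ratioTail ha hb) ⟨k, hk.le⟩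
    ⟨0, (ratioTail_of_nonpos ha hb le_rfl).symm ▸ hα.2.le⟩
  refine ⟨l, ?_, hl⟩
  by_contra h
  rw [ratioTail_of_nonpos ha hb (not_lt.1 h)] at hl
  exact hα.2.ne hl.symm

/-- No sign condition on k: for k ≤ 0 the tail is 1 > α. This is what lets the quantile be computed
over the whole line. -/
lemma ratioTail_le_iff_critRatio_le {α a b : ℝ} (hα : α ∈ Ioo (0 : ℝ) 1) (ha : 0 < a) (hb : 0 < b)
    (k : ℝ) : ratioTail a b k ≤ α ↔ critRatio α a b ≤ k := by
  obtain ⟨h0, h1⟩ := critRatio_spec hα ha hb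
  rcases le_or_gt k 0 with hk | hk
  · rw [ratioTail_of_nonpos ha hb hk]
    exact ⟨fun h => absurd hα.2 (not_lt.2 h), fun h => absurd (h0.trans_le h) (not_lt.2 hk)⟩
  · conv_lhs => rw [← h1]
    exact (strictAntiOn_ratioTail ha hb).le_iff_ge hk.le h0.le

lemma lt_ratioTail_iff_lt_critRatio {α a b : ℝ} (hα : α ∈ Ioo (0 : ℝ) 1) (ha : 0 < a) (hb : 0 < b)
    (k : ℝ) : α < ratioTail a b k ↔ k < critRatio α a b := by
  rw [← not_le, ratioTail_le_iff_critRatio_le hα ha hb, not_le]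

lemma ratioTail_lt_iff_critRatio_lt {α a b : ℝ} (hα : α ∈ Ioo (0 : ℝ) 1) (ha : 0 < a) (hb : 0 < b)
    (k : ℝ) : ratioTail a b k < α ↔ critRatio α a b < k := by
  obtain ⟨h0, h1⟩ := critRatio_spec hα ha hb
  rcases le_or_gt k 0 with hk | hk
  · rw [ratioTail_of_nonpos ha hb hk]
    exact ⟨fun h => absurd hα.2 (not_lt.2 h.le), fun h => absurd (h0.trans h) (not_lt.2 hk)⟩
  · conv_lhs => rw [← h1]
    exact (strictAntiOn_ratioTail ha hb).lt_iff_gt hk.le h0.le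

lemma antitone_ratioTail {a b : ℝ} (ha : 0 < a) (hb : 0 < b) : Antitone (ratioTail a b) := by
  intro k l hkl
  rcases le_or_gt k 0 with hk | hk
  · rw [ratioTail_of_nonpos ha hb hk]
    exact ratioTail_le_one ha hb l
  · exact (strictAntiOn_ratioTail ha hb).antitoneOn hk.le (hk.trans_le hkl).le hkl

/-- The conditional power of the level-`α` test when the Poisson variable has the value `j`. -/
noncomputable def powerTerm (α a b : ℝ) (j : ℕ) : ℝ :=
  ratioTail (a + j) b (critRatio α a b)

lemma powerTerm_mem_Icc {α a b : ℝ} (ha : 0 < a) (hb : 0 < b) (j : ℕ) :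
    powerTerm α a b j ∈ Icc (0 : ℝ) 1 :=
  ⟨ratioTail_nonneg _ _ _, ratioTail_le_one (by positivity) hb _⟩

lemma monotone_powerTerm {α a b : ℝ} (ha : 0 < a) (hb : 0 < b) : Monotone (powerTerm α a b) := by
  refine monotone_nat_of_le_succ fun j => ?_
  have := ratioTail_le_add_left (p := a + j) (by positivity) hb one_pos (critRatio α a b)
  rw [powerTerm, powerTerm]
  push_cast
  rwa [← add_assoc]

/-- Induction on j from equality at j = 0, where both terms are α; each weak inequality yields the
strict one at the next index. -/
lemma powerTerm_lt_of_add_right {α a b e : ℝ} (hα : α ∈ Ioo (0 : ℝ) 1) (ha : 0 < a) (hb : 0 < b)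
    (he : 0 < e) (j : ℕ) :
    powerTerm α a b j ≤ powerTerm α a (b + e) j ∧
      powerTerm α a b (j + 1) < powerTerm α a (b + e) (j + 1) := by
  obtain ⟨h0, h1⟩ := critRatio_spec hα ha hb
  obtain ⟨h0', h1'⟩ := critRatio_spec hα ha (add_pos hb he)
  have step : ∀ j, powerTerm α a b j ≤ powerTerm α a (b + e) j →
      powerTerm α a b (j + 1) < powerTerm α a (b + e) (j + 1) := by
    intro j hj
    have := ratioTail_add_one_lt_of_add_right (by positivity) hb he h0 h0' hj
    rw [powerTerm, powerTerm]
    push_cast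
    rwa [← add_assoc]
  have h : ∀ j, powerTerm α a b j ≤ powerTerm α a (b + e) j := by
    intro j
    induction j with
    | zero => simp [powerTerm, h1, h1']
    | succ j ih => exact (step j ih).le
  exact ⟨h j, step j (h j)⟩

lemma powerTerm_lt_of_transfer {α a b e : ℝ} (hα : α ∈ Ioo (0 : ℝ) 1) (ha : 0 < a) (hb : 0 < b)
    (he : 0 < e) (j : ℕ) :
    powerTerm α (a + e) b j ≤ powerTerm α a (b + e) j ∧
      powerTerm α (a + e) b (j + 1) < powerTerm α a (b + e) (j + 1) := by
  obtain ⟨h0, h1⟩ := critRatio_spec hα (add_pos ha he) hb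
  obtain ⟨h0', h1'⟩ := critRatio_spec hα ha (add_pos hb he)
  have step : ∀ j, powerTerm α (a + e) b j ≤ powerTerm α a (b + e) j →
      powerTerm α (a + e) b (j + 1) < powerTerm α a (b + e) (j + 1) := by
    intro j hj
    rw [powerTerm, powerTerm, add_right_comm] at hj
    have := ratioTail_add_one_lt_of_transfer (by positivity) hb he h0 h0' hj
    rw [powerTerm, powerTerm]
    push_cast
    rwa [← add_assoc, ← add_assoc, add_right_comm a e, add_right_comm (a + j) e]
  have h : ∀ j, powerTerm α (a + e) b j ≤ powerTerm α a (b + e) j := by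
    intro j
    induction j with
    | zero => simp [powerTerm, h1, h1']
    | succ j ih => exact (step j ih).le
  exact ⟨h j, step j (h j)⟩

/-- Factor the change into a transfer of a - a' from numerator to denominator, followed by an
increase of the denominator shape; either part may be void, but not both since b < b'. -/
lemma powerTerm_lt {α a b a' b' : ℝ} (hα : α ∈ Ioo (0 : ℝ) 1) (ha' : 0 < a') (haa : a' ≤ a)
    (hb : 0 < b) (hbb : b < b') (hab : a + b ≤ a' + b') (j : ℕ) :
    powerTerm α a b j ≤ powerTerm α a' b' j ∧
      powerTerm α a b (j + 1) < powerTerm α a' b' (j + 1) := by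
  rcases haa.eq_or_lt with rfl | haa
  · have := powerTerm_lt_of_add_right hα ha' hb (sub_pos.2 hbb) j
    rwa [add_sub_cancel] at this
  · have h1 := powerTerm_lt_of_transfer hα ha' hb (sub_pos.2 haa) j
    rw [add_sub_cancel] at h1
    have hle : b + (a - a') ≤ b' := by linarith
    rcases hle.eq_or_lt with h | h
    · rwa [h] at h1
    · have h2 := powerTerm_lt_of_add_right hα ha' (add_pos hb (sub_pos.2 haa)) (sub_pos.2 h) j
      rw [add_sub_cancel] at h2
      exact ⟨h1.1.trans h2.1, h1.2.trans h2.2⟩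

/-- Being on one side of the critical value is a strict inequality for the tail at a fixed k, hence
an open condition on b. -/
lemma continuousAt_critRatio {α a b : ℝ} (hα : α ∈ Ioo (0 : ℝ) 1) (ha : 0 < a) (hb : 0 < b) :
    ContinuousAt (critRatio α a) b := by
  refine tendsto_order.2 ⟨fun k hk => ?_, fun k hk => ?_⟩
  · have h := (lt_ratioTail_iff_lt_critRatio hα ha hb k).2 hk
    filter_upwards [(continuousAt_ratioTail_right ha hb k).eventually_const_lt h,
      lt_mem_nhds hb] with s hs hs0
    exact (lt_ratioTail_iff_lt_critRatio hα ha hs0 k).1 hs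
  · have h := (ratioTail_lt_iff_critRatio_lt hα ha hb k).2 hk
    filter_upwards [(continuousAt_ratioTail_right ha hb k).eventually_lt_const h,
      lt_mem_nhds hb] with s hs hs0
    exact (ratioTail_lt_iff_critRatio_lt hα ha hs0 k).1 hs

lemma continuousAt_powerTerm {α a b : ℝ} (hα : α ∈ Ioo (0 : ℝ) 1) (ha : 0 < a) (hb : 0 < b)
    (j : ℕ) : ContinuousAt (fun b => powerTerm α a b j) b := by
  have haj : 0 < a + j := by positivity
  have hc := (continuous_ratioTail haj hb).continuousAt (x := critRatio α a b)
  refine tendsto_order.2 ⟨fun y hy => ?_, fun y hy => ?_⟩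
  -- Joint continuity in (k, b) is avoided: freeze a k just beyond the critical value, vary b at
  -- this k, and return to the moving critical value by monotonicity in k.
  · have h1 : ∀ᶠ k in 𝓝[>] (critRatio α a b), y < ratioTail (a + j) b k :=
      (hc.eventually_const_lt hy).filter_mono nhdsWithin_le_nhds
    obtain ⟨k, hk, hk'⟩ := (h1.and self_mem_nhdsWithin).exists
    filter_upwards [(continuousAt_ratioTail_right haj hb k).eventually_const_lt hk,
      (continuousAt_critRatio hα ha hb).eventually_lt_const hk', lt_mem_nhds hb] with s h1 h2 h3
    exact h1.trans_le (antitone_ratioTail haj h3 h2.le)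
  · have h1 : ∀ᶠ k in 𝓝[<] (critRatio α a b), ratioTail (a + j) b k < y :=
      (hc.eventually_lt_const hy).filter_mono nhdsWithin_le_nhds
    obtain ⟨k, hk, hk'⟩ := (h1.and self_mem_nhdsWithin).exists
    filter_upwards [(continuousAt_ratioTail_right haj hb k).eventually_lt_const hk,
      (continuousAt_critRatio hα ha hb).eventually_const_lt hk', lt_mem_nhds hb] with s h1 h2 h3
    exact (antitone_ratioTail haj h3 h2.le).trans_lt h1

/-! ### Poisson mixtures -/

/-- The Poisson probabilities with mean `x`. -/
noncomputable def poissonWeight (x : ℝ) (j : ℕ) : ℝ :=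
  Real.exp (-x) * x ^ j / (j.factorial : ℝ)

lemma poissonWeight_nonneg {x : ℝ} (hx : 0 ≤ x) (j : ℕ) : 0 ≤ poissonWeight x j := by
  unfold poissonWeight; positivity

lemma hasSum_poissonWeight (x : ℝ) : HasSum (poissonWeight x) 1 := by
  have h := (NormedSpace.expSeries_div_hasSum_exp x).mul_left (Real.exp (-x))
  rw [← Real.exp_eq_exp_ℝ, ← Real.exp_add, neg_add_cancel, Real.exp_zero] at h
  have e : poissonWeight x = fun j => Real.exp (-x) * (x ^ j / (j.factorial : ℝ)) :=
    funext fun j => mul_div_assoc _ _ _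
  rwa [e]

lemma summable_poissonWeight_mul {x : ℝ} (hx : 0 ≤ x) {G : ℕ → ℝ} (hG : ∀ j, G j ∈ Icc (0 : ℝ) 1) :
    Summable fun j => poissonWeight x j * G j :=
  (hasSum_poissonWeight x).summable.of_nonneg_of_le
    (fun j => mul_nonneg (poissonWeight_nonneg hx j) (hG j).1)
    (fun j => mul_le_of_le_one_right (poissonWeight_nonneg hx j) (hG j).2)

lemma sum_antidiagonal_poissonWeight (x y : ℝ) (n : ℕ) :
    ∑ ij ∈ Finset.HasAntidiagonal.antidiagonal n, poissonWeight x ij.1 * poissonWeight y ij.2 =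
      poissonWeight (x + y) n := by
  have h : (x + y) ^ n = ∑ ij ∈ Finset.HasAntidiagonal.antidiagonal n, (n.choose ij.1 : ℝ) * (x ^ ij.1 * y ^ ij.2) := by
    rw [(Commute.all x y).add_pow']
    simp [nsmul_eq_mul]
  rw [poissonWeight, h, Finset.mul_sum, Finset.sum_div]
  refine Finset.sum_congr rfl fun ij hij => ?_
  rw [Finset.HasAntidiagonal.mem_antidiagonal] at hij
  subst hij
  rw [poissonWeight, poissonWeight, neg_add, Real.exp_add, Nat.cast_add_choose]
  have := Nat.factorial_ne_zero (ij.1 + ij.2)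
  field_simp

/-- With y = x + z, a Poisson variable of mean y is one of mean x plus an independent one of mean z
≥ 0, so the expectation of a monotone function grows. The Cauchy product expresses this coupling. -/
lemma tsum_poissonWeight_mul_mono {x y : ℝ} (hx : 0 ≤ x) (hxy : x ≤ y) {G : ℕ → ℝ}
    (hG : ∀ j, G j ∈ Icc (0 : ℝ) 1) (hmono : Monotone G) :
    ∑' j, poissonWeight x j * G j ≤ ∑' j, poissonWeight y j * G j := by
  obtain ⟨z, rfl⟩ := exists_add_of_le hxy
  have hz : 0 ≤ z := by linarith
  have hs := summable_poissonWeight_mul hx hG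
  have hw := (hasSum_poissonWeight z)
  have h := tsum_mul_tsum_eq_tsum_sum_antidiagonal_of_summable_norm hs.norm hw.summable.norm
  rw [hw.tsum_eq, mul_one] at h
  rw [h]
  refine Summable.tsum_le_tsum (fun n => ?_) ?_ (summable_poissonWeight_mul (by linarith) hG)
  · rw [← sum_antidiagonal_poissonWeight, Finset.sum_mul]
    refine Finset.sum_le_sum fun ij hij => ?_
    rw [mul_right_comm]
    refine mul_le_mul_of_nonneg_left (hmono (Nat.le.intro (Finset.HasAntidiagonal.mem_antidiagonal.1 hij)))
      (mul_nonneg (poissonWeight_nonneg hx _) (poissonWeight_nonneg hz _))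
  · exact (summable_norm_sum_mul_antidiagonal_of_summable_norm hs.norm hw.summable.norm).of_norm

/-- Strictness is asked at index 1, not 0: in the application both terms at index 0 equal the level
α. -/
lemma tsum_poissonWeight_mul_lt {x : ℝ} (hx : 0 < x) {G H : ℕ → ℝ}
    (hG : ∀ j, G j ∈ Icc (0 : ℝ) 1) (hH : ∀ j, H j ∈ Icc (0 : ℝ) 1) (hle : ∀ j, G j ≤ H j)
    (hlt : G 1 < H 1) :
    ∑' j, poissonWeight x j * G j < ∑' j, poissonWeight x j * H j := by
  refine Summable.tsum_lt_tsum (i := 1)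
    (fun j => mul_le_mul_of_nonneg_left (hle j) (poissonWeight_nonneg hx.le j))
    (mul_lt_mul_of_pos_left hlt ?_) (summable_poissonWeight_mul hx.le hG)
    (summable_poissonWeight_mul hx.le hH)
  unfold poissonWeight; positivity

/-! ### The power of the `F`-test as a Poisson mixture -/

lemma noncentralChiSq_zero (k : ℝ) : noncentralChiSq k 0 = halfGamma (k / 2) := by
  ext s hs
  rw [noncentralChiSq, Measure.sum_apply _ hs, tsum_eq_single 0]
  · simp [halfGamma]
  · intro j hj
    simp [hj]

lemma noncentralF_real_Ioi {ν₁ ν₂ l : ℝ} (h₁ : 0 < ν₁) (h₂ : 0 < ν₂) (hl : 0 ≤ l) (x : ℝ) :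
    (noncentralF ν₁ ν₂ l).real (Ioi x) =
      ∑' j : ℕ, poissonWeight (l / 2) j * ratioTail (ν₁ / 2 + j) (ν₂ / 2) (x * (ν₁ / ν₂)) := by
  have hm : Measurable fun x : ℝ × ℝ => (x.1 / ν₁) / (x.2 / ν₂) := by fun_prop
  have := isProbabilityMeasure_halfGamma (half_pos h₂)
  have hpre : MeasurableSet ((fun x : ℝ × ℝ => (x.1 / ν₁) / (x.2 / ν₂)) ⁻¹' Ioi x) :=
    hm measurableSet_Ioi
  rw [measureReal_def, noncentralF, Measure.map_apply hm measurableSet_Ioi, noncentralChiSq_zero,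
    noncentralChiSq, Measure.prod_sum_left, Measure.sum_apply _ hpre, ENNReal.tsum_toReal_eq]
  · refine tsum_congr fun j => ?_
    rw [Measure.prod_smul_left, Measure.smul_apply, smul_eq_mul, ENNReal.toReal_mul,
      ENNReal.toReal_ofReal (by positivity)]
    congr 1
    rw [ratioTail, measureReal_def]
    congr 1
    -- The two events agree only where the denominator variable is positive, which holds almost
    -- surely.
    refine measure_congr ?_
    filter_upwards [Measure.quasiMeasurePreserving_snd (μ := halfGamma (ν₁ / 2 + j))
      (ν := halfGamma (ν₂ / 2)) |>.ae (ae_halfGamma_pos (ν₂ / 2))] with y hy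
    refine propext ?_
    change x < (y.1 / ν₁) / (y.2 / ν₂) ↔ x * (ν₁ / ν₂) * y.2 < y.1
    rw [div_div_div_eq, lt_div_iff₀ (by positivity), ← mul_lt_mul_iff_left₀ h₂ (b := _ * y.2)]
    have : x * (ν₁ / ν₂) * y.2 * ν₂ = x * (ν₁ * y.2) := by field_simp
    rw [this]
  · intro j
    have := isProbabilityMeasure_halfGamma (show 0 < ν₁ / 2 + j by positivity)
    rw [Measure.prod_smul_left, Measure.smul_apply, smul_eq_mul]
    exact ENNReal.mul_ne_top ENNReal.ofReal_ne_top (measure_ne_top _ _)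

lemma isProbabilityMeasure_noncentralF_zero {ν₁ ν₂ : ℝ} (h₁ : 0 < ν₁) (h₂ : 0 < ν₂) :
    IsProbabilityMeasure (noncentralF ν₁ ν₂ 0) := by
  have := isProbabilityMeasure_halfGamma (half_pos h₁)
  have := isProbabilityMeasure_halfGamma (half_pos h₂)
  rw [noncentralF, noncentralChiSq_zero, noncentralChiSq_zero]
  exact Measure.isProbabilityMeasure_map (Measurable.aemeasurable (by fun_prop))

lemma quantile_noncentralF_zero {α ν₁ ν₂ : ℝ} (hα : α ∈ Ioo (0 : ℝ) 1) (h₁ : 0 < ν₁)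
    (h₂ : 0 < ν₂) : quantile (noncentralF ν₁ ν₂ 0) (1 - α) =
      critRatio α (ν₁ / 2) (ν₂ / 2) / (ν₁ / ν₂) := by
  have := isProbabilityMeasure_noncentralF_zero h₁ h₂
  have h : {x : ℝ | 1 - α ≤ cdf (noncentralF ν₁ ν₂ 0) x} =
      Ici (critRatio α (ν₁ / 2) (ν₂ / 2) / (ν₁ / ν₂)) := by
    ext x
    rw [mem_ofPred_eq, cdf_eq_real, ← compl_Ioi, probReal_compl_eq_one_sub measurableSet_Ioi,
      noncentralF_real_Ioi h₁ h₂ le_rfl, tsum_eq_single 0 (by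
        intro j hj; simp [poissonWeight, hj]), mem_Ici, div_le_iff₀ (by positivity),
      ← ratioTail_le_iff_critRatio_le hα (by positivity) (by positivity)]
    simp only [poissonWeight, zero_div, neg_zero, Real.exp_zero, pow_zero, Nat.factorial_zero,
      Nat.cast_one, div_one, Nat.cast_zero, add_zero, one_mul]
    constructor <;> intro h <;> linarith
  rw [quantile, h, csInf_Ici]

lemma fTestPower_eq_tsum {α ν₁ ν₂ l : ℝ} (hα : α ∈ Ioo (0 : ℝ) 1) (h₁ : 0 < ν₁) (h₂ : 0 < ν₂)
    (hl : 0 ≤ l) : fTestPower α ν₁ ν₂ l =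
      ∑' j : ℕ, poissonWeight (l / 2) j * powerTerm α (ν₁ / 2) (ν₂ / 2) j := by
  rw [fTestPower, noncentralF_real_Ioi h₁ h₂ hl, quantile_noncentralF_zero hα h₁ h₂,
    div_mul_cancel₀ _ (by positivity)]
  rfl

/-- Moving degrees of freedom from the numerator to the denominator, adding degrees of freedom to
the denominator and raising the noncentrality increases the power of the `F`-test. -/
theorem fTestPower_lt {α ν₁ ν₂ l ν₁' ν₂' l' : ℝ} (hα : α ∈ Ioo (0 : ℝ) 1) (h₁' : 0 < ν₁')
    (h₁ : ν₁' ≤ ν₁) (h₂ : 0 < ν₂) (h₂' : ν₂ < ν₂') (h₁₂ : ν₁ + ν₂ ≤ ν₁' + ν₂') (hl : 0 < l)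
    (hl' : l ≤ l') : fTestPower α ν₁ ν₂ l < fTestPower α ν₁' ν₂' l' := by
  have a' : 0 < ν₁' / 2 := by positivity
  have a : 0 < ν₁ / 2 := by linarith
  have b : 0 < ν₂ / 2 := by positivity
  have b' : 0 < ν₂' / 2 := by linarith
  rw [fTestPower_eq_tsum hα (by linarith) h₂ hl.le, fTestPower_eq_tsum hα h₁' (by linarith)
    (by linarith)]
  have key := powerTerm_lt hα a' (show ν₁' / 2 ≤ ν₁ / 2 by linarith) b
    (show ν₂ / 2 < ν₂' / 2 by linarith) (by linarith)
  exact (tsum_poissonWeight_mul_lt (half_pos hl) (powerTerm_mem_Icc a b) (powerTerm_mem_Icc a' b')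
    (fun j => (key j).1) (key 0).2).trans_le (tsum_poissonWeight_mul_mono (by linarith)
      (by linarith) (powerTerm_mem_Icc a' b') (monotone_powerTerm a' b'))

/-- The numerator degrees of freedom stay fixed because they are constant when only the pivot
varies. The series is dominated near l by the exponential series at l, since a noncentrality below
2l has Poisson mean below l. -/
lemma continuousAt_fTestPower {α ν₁ ν₂ l : ℝ} (hα : α ∈ Ioo (0 : ℝ) 1) (h₁ : 0 < ν₁) (h₂ : 0 < ν₂)
    (hl : 0 < l) : ContinuousAt (fun q : ℝ × ℝ => fTestPower α ν₁ q.1 q.2) (ν₂, l) := by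
  have hev : ∀ᶠ q : ℝ × ℝ in 𝓝 (ν₂, l), 0 < q.1 ∧ 0 < q.2 ∧ q.2 < 2 * l := by
    filter_upwards [continuousAt_fst.eventually_const_lt h₂,
      continuousAt_snd.eventually_const_lt hl,
      continuousAt_snd.eventually_lt_const (show l < 2 * l by linarith)] with q h1 h2 h3
    exact ⟨h1, h2, h3⟩
  have hcongr : (fun q : ℝ × ℝ => fTestPower α ν₁ q.1 q.2) =ᶠ[𝓝 (ν₂, l)] fun q =>
      ∑' j : ℕ, poissonWeight (q.2 / 2) j * powerTerm α (ν₁ / 2) (q.1 / 2) j := by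
    filter_upwards [hev] with q hq
    exact fTestPower_eq_tsum hα h₁ hq.1 hq.2.1.le
  refine ContinuousAt.congr ?_ hcongr.symm
  refine tendsto_tsum_of_dominated_convergence (bound := fun j : ℕ => l ^ j / (j.factorial : ℝ))
    (NormedSpace.expSeries_div_summable l) (fun j => ?_) ?_
  · refine ContinuousAt.mul ?_ ?_
    · unfold poissonWeight; fun_prop
    · exact ContinuousAt.comp (f := fun q : ℝ × ℝ => q.1 / 2) (x := (ν₂, l))
        (g := fun b => powerTerm α (ν₁ / 2) b j)
        (continuousAt_powerTerm hα (half_pos h₁) (half_pos h₂) j)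
        (by fun_prop)
  · filter_upwards [hev] with q ⟨hq1, hq2, hq3⟩ j
    have hG := powerTerm_mem_Icc (α := α) (half_pos h₁) (half_pos hq1) j
    have hw := poissonWeight_nonneg (half_pos hq2).le j
    rw [Real.norm_of_nonneg (mul_nonneg hw hG.1)]
    refine (mul_le_of_le_one_right hw hG.2).trans ?_
    rw [poissonWeight, mul_div_assoc]
    refine (mul_le_of_le_one_left (by positivity) (Real.exp_le_one_iff.2 (by linarith))).trans ?_
    gcongr
    linarith

/-! ### Scaling a parameter: degrees of freedom and noncentrality -/

namespace Model

lemma scale_same (d : Param → ℝ) (x : Param) (t : ℝ) : scale d x t x = t * d x := by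
  simp [scale]

lemma scale_of_ne (d : Param → ℝ) {x y : Param} (h : y ≠ x) (t : ℝ) : scale d x t y = d y := by
  simp [scale, h]

lemma pivot_mem_params (m : Model) : m.pivot ∈ m.params := by
  cases m <;> simp [params, pivot]

variable {m : Model} {d d' : Param → ℝ}

lemma df₁_congr (h : ∀ x ∈ m.params, d x = d' x) (a : ℝ) : m.df₁ a d = m.df₁ a d' := by
  cases m <;> simp only [params, Finset.mem_insert, Finset.mem_singleton, forall_eq_or_imp,
    forall_eq] at h <;> simp only [df₁, h]

lemma df₂_congr (h : ∀ x ∈ m.params, d x = d' x) (a : ℝ) : m.df₂ a d = m.df₂ a d' := by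
  cases m <;> simp only [params, Finset.mem_insert, Finset.mem_singleton, forall_eq_or_imp,
    forall_eq] at h <;> simp only [df₂, h]

lemma noncentrality_congr (h : ∀ x ∈ m.params, d x = d' x) (a : ℝ) (e : Effects)
    (s : VarComp → ℝ) : m.noncentrality a e s d = m.noncentrality a e s d' := by
  have hR : m.R d = m.R d' := by
    cases m <;> simp only [params, Finset.mem_insert, Finset.mem_singleton, forall_eq_or_imp,
      forall_eq] at h <;> simp only [R, h]
  have hT : m.T s d = m.T s d' := by
    cases m <;> simp only [params, Finset.mem_insert, Finset.mem_singleton, forall_eq_or_imp,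
      forall_eq] at h <;> simp only [T, h]
  have hS : e.S m a d = e.S m a d' := by
    cases e <;> cases m <;> simp only [params, Finset.mem_insert, Finset.mem_singleton,
      forall_eq_or_imp, forall_eq] at h <;>
      simp only [Effects.S, effectCount, leastSumSq, h]
  rw [noncentrality, noncentrality, hR, hT, hS]

lemma power_congr (h : ∀ x ∈ m.params, d x = d' x) (a α : ℝ) (e : Effects) (s : VarComp → ℝ) :
    m.power a α e s d = m.power a α e s d' := by
  rw [power, power, df₁_congr h, df₂_congr h, noncentrality_congr h]

lemma size_congr (h : ∀ x ∈ m.params, d x = d' x) (a : ℝ) : m.size a d = m.size a d' := by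
  rw [size, size, Finset.prod_congr rfl h]

lemma size_scale {x : Param} (hx : x ∈ m.params) (a t : ℝ) :
    m.size a (scale d x t) = t * m.size a d := by
  rw [size, size, scale, Finset.prod_update_of_mem hx, Finset.sdiff_singleton_eq_erase,
    ← Finset.mul_prod_erase _ _ hx]
  ring

lemma df₁_pos {a : ℝ} (ha : 2 ≤ a) (hd : ∀ x ∈ m.params, 1 < d x) : 0 < m.df₁ a d := by
  have ha' : 0 < a - 1 := by linarith
  cases m <;> simp only [params, Finset.mem_insert, Finset.mem_singleton, forall_eq_or_imp,
    forall_eq] at hd <;> simp only [df₁] <;> try exact ha'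
  all_goals
    have h1 := hd.1
    have h2 := hd.2
    try have h3 := h2.1
    have : 0 < d .v := by linarith
    try have : 0 < d .u := by linarith
    positivity

lemma df₂_pos {a : ℝ} (ha : 2 ≤ a) (hd : ∀ x ∈ m.params, 1 < d x) : 0 < m.df₂ a d := by
  have ha' : 0 < a - 1 := by linarith
  have ha0 : 0 < a := by linarith
  have key : ∀ x ∈ m.params, 0 < d x ∧ 0 < d x - 1 := fun x hx =>
    ⟨by linarith [hd x hx], by linarith [hd x hx]⟩
  clear hd
  cases m <;> simp only [params, Finset.mem_insert, Finset.mem_singleton, forall_eq_or_imp,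
    forall_eq] at key <;> simp only [df₂] <;>
    (repeat' apply mul_pos) <;> simp only [key, ha', ha0]

lemma R_pos (hd : ∀ x ∈ m.params, 1 < d x) : 0 < m.R d := by
  have key : ∀ x ∈ m.params, 0 < d x := fun x hx => by linarith [hd x hx]
  clear hd
  cases m <;> simp only [params, Finset.mem_insert, Finset.mem_singleton, forall_eq_or_imp,
    forall_eq] at key <;> simp only [R, key, mul_pos]

lemma T_pos {s : VarComp → ℝ} (hs : ∀ c, 0 ≤ s c) (hact : 0 < m.activeVariance s)
    (hd : ∀ x ∈ m.params, 1 < d x) : 0 < m.T s d := by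
  have key : ∀ x ∈ m.params, 0 < d x := fun x hx => by linarith [hd x hx]
  clear hd
  -- Only the sum of the components is known to be positive; if A vanishes, B must be positive.
  have aux : ∀ A B y : ℝ, 0 ≤ A → 0 ≤ B → 0 < y → 0 < A + B → 0 < A + 1 / y * B := by
    intro A B y hA hB hy h
    rcases hA.eq_or_lt with rfl | hA
    · have : 0 < B := by linarith
      positivity
    · positivity
  have aux' : ∀ A B C y z : ℝ, 0 ≤ A → 0 ≤ B → 0 ≤ C → 0 < y → 0 < z → 0 < A + B + C →
      0 < A + 1 / y * B + 1 / z * C := by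
    intro A B C y z hA hB hC hy hz h
    refine aux _ _ _ (by positivity) hC hz ?_
    rw [add_right_comm]
    exact aux _ _ _ (by positivity) hB hy (by linarith)
  rw [activeVariance] at hact
  cases m <;> simp only [params, Finset.mem_insert, Finset.mem_singleton, forall_eq_or_imp,
    forall_eq] at key <;> simp only [T, mul_one, div_one, one_mul] at hact ⊢ <;>
    first
    | exact hact
    | exact aux _ _ _ (hs _) (hs _) (by simp only [key, mul_pos]) hact
    | exact aux' _ _ _ _ _ (hs _) (hs _) (hs _) (by simp only [key]) (by simp only [key, mul_pos]) hact

/-- The middle one of three numbers. -/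
lemma sum_sub_min_sub_max (a u v : ℝ) :
    a + u + v - min a (min u v) - max a (max u v) = max (min a u) (min (max a u) v) := by
  simp only [min_def, max_def]
  split_ifs <;> linarith

lemma div_sub_one_pos {x : ℝ} (hx : 1 < x) : 0 < x / (x - 1) :=
  div_pos (by linarith) (by linarith)

lemma div_sub_one_anti {x y : ℝ} (hx : 1 < x) (hxy : x ≤ y) : y / (y - 1) ≤ x / (x - 1) := by
  rw [div_le_div_iff₀ (by linarith) (by linarith)]
  linarith

/-- The factor in the least sum of squares for models in which `A` is nested in two factors. -/
noncomputable def leastFactor (a u v : ℝ) : ℝ :=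
  max (min a u) (min (max a u) v) / (max (min a u) (min (max a u) v) - 1) *
    (max a (max u v) / (max a (max u v) - 1))

lemma one_lt_middle {a u v : ℝ} (ha : 1 < a) (hu : 1 < u) : 1 < max (min a u) (min (max a u) v) :=
  lt_max_of_lt_left (lt_min ha hu)

lemma leastFactor_pos {a u v : ℝ} (ha : 1 < a) (hu : 1 < u) : 0 < leastFactor a u v :=
  mul_pos (div_sub_one_pos (one_lt_middle ha hu)) (div_sub_one_pos (lt_max_of_lt_left ha))

/-- The median and the maximum of a, u, v are monotone in u and v, and x / (x - 1) decreases on x >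
1. -/
lemma leastFactor_anti {a u v u' v' : ℝ} (ha : 1 < a) (hu : 1 < u) (huu : u ≤ u') (hvv : v ≤ v') :
    leastFactor a u' v' ≤ leastFactor a u v := by
  refine mul_le_mul (div_sub_one_anti (one_lt_middle ha hu) ?_)
    (div_sub_one_anti (lt_max_of_lt_left ha) ?_) (div_sub_one_pos (lt_max_of_lt_left ha)).le
    (div_sub_one_pos (one_lt_middle ha hu)).le <;> gcongr

lemma leastFactor_eq (a u v : ℝ) :
    (a + u + v - min a (min u v) - max a (max u v)) * max a (max u v) /
      ((a + u + v - min a (min u v) - max a (max u v) - 1) * (max a (max u v) - 1)) =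
      leastFactor a u v := by
  rw [sum_sub_min_sub_max, mul_div_mul_comm, leastFactor]

lemma S_pos {a : ℝ} (ha : 2 ≤ a) {e : Effects} (he : e.Pos) (hd : ∀ x ∈ m.params, 1 < d x) :
    0 < e.S m a d := by
  have ha1 : 1 < a := by linarith
  have ha0 : 0 < a := by linarith
  have key : ∀ x ∈ m.params, 0 < d x := fun x hx => by linarith [hd x hx]
  rcases e with S | q | δ <;> have he' := he <;> simp only [Effects.Pos] at he' <;>
    simp only [Effects.S]
  · exact he'
  · refine mul_pos he' ?_
    cases m <;> simp only [params, Finset.mem_insert, Finset.mem_singleton, forall_eq_or_imp,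
      forall_eq] at key <;> simp only [effectCount, key, ha0, mul_pos]
  · have hδ : 0 < δ ^ 2 / 2 := by positivity
    cases m <;> simp only [params, Finset.mem_insert, Finset.mem_singleton, forall_eq_or_imp,
      forall_eq] at hd <;> simp only [leastSumSq, leastFactor_eq] <;>
      first
      | exact hδ
      | exact mul_pos hδ (div_sub_one_pos (lt_max_of_lt_right ha1))
      | exact mul_pos hδ (leastFactor_pos ha1 hd.1)

lemma df₁_scale_pivot (m : Model) (a : ℝ) (d : Param → ℝ) (t : ℝ) :
    m.df₁ a (scale d m.pivot t) = m.df₁ a d := by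
  cases m <;> simp [df₁, scale, pivot]

/-- The factor of the denominator degrees of freedom that does not depend on the pivot. -/
noncomputable def df₂Factor (m : Model) (a : ℝ) (d : Param → ℝ) : ℝ :=
  m.df₂ a (Function.update d m.pivot 2)

lemma df₂_eq_factor_mul (m : Model) (a : ℝ) (d : Param → ℝ) :
    m.df₂ a d = m.df₂Factor a d * (d m.pivot - 1) := by
  cases m <;> simp only [df₂Factor, df₂, pivot, Function.update_self, ne_eq, reduceCtorEq,
    not_false_eq_true, Function.update_of_ne] <;> ring

lemma df₂Factor_pos {a : ℝ} (ha : 2 ≤ a) (hd : ∀ x ∈ m.params, 1 < d x) : 0 < m.df₂Factor a d := by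
  refine df₂_pos ha fun x hx => ?_
  rcases eq_or_ne x m.pivot with rfl | h
  · simp
  · simpa [h] using hd x hx

lemma df₂_scale_pivot (m : Model) (a : ℝ) (d : Param → ℝ) (t : ℝ) :
    m.df₂ a (scale d m.pivot t) = m.df₂Factor a d * (t * d m.pivot - 1) := by
  rw [df₂_eq_factor_mul, df₂Factor, scale, Function.update_idem, Function.update_self, df₂Factor]

/-- With c = `df₂Factor` and pivot p, the inequality `df₁` ≤ c in the last case is exactly what
makes t(`df₁` + c(p - 1)) ≤ `df₁` + c(tp - 1), so that the pivot wins in total degrees of freedom.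
-/
lemma df_scale_of_ne_pivot {a : ℝ} (ha : 2 ≤ a) (hd : ∀ x ∈ m.params, 1 < d x) {x : Param}
    (hx : x ∈ m.params) (hxp : x ≠ m.pivot) (t : ℝ) :
    m.df₁ a (scale d x t) = m.df₁ a d ∧
      (m.df₂ a (scale d x t) = m.df₂ a d ∨ m.df₂ a (scale d x t) = t * m.df₂ a d) ∨
    m.df₁ a (scale d x t) = t * m.df₁ a d ∧ m.df₂ a (scale d x t) = t * m.df₂ a d ∧
      m.df₁ a d ≤ m.df₂Factor a d := by
  have ha0 : 0 < a := by linarith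
  have key : ∀ x ∈ m.params, 0 < d x := fun x hx => by linarith [hd x hx]
  cases m <;> cases x <;> simp [params, pivot] at hx hxp <;>
    simp only [params, Finset.mem_insert, Finset.mem_singleton, forall_eq_or_imp,
      forall_eq] at key hd <;>
    simp only [df₂Factor, df₁, df₂, scale, pivot, Function.update_self, ne_eq, reduceCtorEq,
      not_false_eq_true, Function.update_of_ne] <;>
    first
    | exact Or.inl ⟨trivial, Or.inl trivial⟩
    | exact Or.inl ⟨trivial, Or.inr (by ring1)⟩
    | refine Or.inr ⟨by ring1, by ring1, ?_⟩
      first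
      | linarith [key.1]
      | linarith [mul_pos key.1 key.2.1]
      | linarith [key.1, mul_nonneg (mul_pos key.1 ha0).le (sub_nonneg.2 hd.2.1.le)]

lemma R_scale_pivot (m : Model) (d : Param → ℝ) (t : ℝ) :
    m.R (scale d m.pivot t) = t * m.R d := by
  cases m <;> simp only [R, scale, pivot, Function.update_self, ne_eq, reduceCtorEq,
    not_false_eq_true, Function.update_of_ne] <;> ring

lemma T_scale_pivot (m : Model) (s : VarComp → ℝ) (d : Param → ℝ) (t : ℝ) :
    m.T s (scale d m.pivot t) = m.T s d := by
  cases m <;> simp [T, scale, pivot]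

lemma S_scale_pivot (m : Model) (a : ℝ) (e : Effects) (d : Param → ℝ) (t : ℝ) :
    e.S m a (scale d m.pivot t) = e.S m a d := by
  cases e <;> cases m <;> simp [Effects.S, effectCount, leastSumSq, scale, pivot]

lemma S_scale_of_ne {x : Param} (hu : x ≠ .u) (hv : x ≠ .v) (m : Model) (a : ℝ) (e : Effects)
    (d : Param → ℝ) (t : ℝ) : e.S m a (scale d x t) = e.S m a d := by
  cases e <;> cases m <;> simp [Effects.S, effectCount, leastSumSq, scale, hu.symm, hv.symm]

/-- A fixed sum of squares does not change, a fixed mean square contributes at most the factor t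
through the number of effects, and the least favorable sum of squares does not increase with u or v.
-/
lemma S_scale_le {a : ℝ} (ha : 2 ≤ a) {e : Effects} (he : e.Pos)
    (hd : ∀ x ∈ m.params, 1 < d x) {x : Param} (hx : x ∈ m.params) {t : ℝ} (ht : 1 < t) :
    e.S m a (scale d x t) ≤ t * e.S m a d := by
  have hS := S_pos ha he hd
  have ha1 : 1 < a := by linarith
  have hup : ∀ y ∈ m.params, d y ≤ scale d x t y := by
    intro y hy
    rcases eq_or_ne y x with rfl | h
    · rw [scale_same]
      exact le_mul_of_one_le_left (by linarith [hd y hy]) ht.le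
    · rw [scale_of_ne _ h]
  rcases e with S | q | δ <;> simp only [Effects.S] at hS ⊢
  · exact le_mul_of_one_le_left hS.le ht.le
  · have hcount : 0 < m.effectCount a d := pos_of_mul_pos_right hS (le_of_lt he)
    rw [mul_left_comm]
    refine mul_le_mul_of_nonneg_left ?_ (le_of_lt he)
    have : m.effectCount a (scale d x t) = m.effectCount a d ∨
        m.effectCount a (scale d x t) = t * m.effectCount a d := by
      cases m <;> cases x <;> simp [params] at hx <;>
        simp only [effectCount, scale, Function.update_self, ne_eq, reduceCtorEq,
          not_false_eq_true, Function.update_of_ne] <;>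
        first
        | exact Or.inl trivial
        | exact Or.inr (by ring1)
    rcases this with h | h <;> rw [h]
    exact le_mul_of_one_le_left hcount.le ht.le
  · refine le_trans ?_ (le_mul_of_one_le_left hS.le ht.le)
    have hδ : 0 ≤ δ ^ 2 / 2 := by positivity
    clear hS
    cases m <;> simp only [params, Finset.mem_insert, Finset.mem_singleton, forall_eq_or_imp,
      forall_eq] at hd hup <;> simp only [leastSumSq, leastFactor_eq] <;>
      first
      | exact le_rfl
      | exact mul_le_mul_of_nonneg_left (div_sub_one_anti (lt_max_of_lt_right ha1)
          (max_le_max_right _ hup.1)) hδ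
      | exact mul_le_mul_of_nonneg_left (leastFactor_anti ha1 hd.1 hup.1 hup.2.1) hδ

/-- At most one factor of R S / T can gain from scaling a non-pivot parameter. If R or T changes,
the parameter is neither u nor v, so S does not change, and the gain is again at most t. -/
lemma R_T_scale_of_ne_pivot {s : VarComp → ℝ} (hs : ∀ c, 0 ≤ s c)
    (hd : ∀ x ∈ m.params, 1 < d x) {x : Param}
    (hx : x ∈ m.params) (hxp : x ≠ m.pivot) {t : ℝ} (ht : 1 < t) :
    (m.R (scale d x t) = m.R d ∧ m.T s (scale d x t) = m.T s d) ∨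
    (x ≠ .u ∧ x ≠ .v ∧ ((m.R (scale d x t) = t * m.R d ∧ m.T s (scale d x t) = m.T s d) ∨
      (m.R (scale d x t) = m.R d ∧ m.T s d ≤ t * m.T s (scale d x t)))) := by
  have key : ∀ x ∈ m.params, 0 < d x := fun x hx => by linarith [hd x hx]
  have ht0 : 0 < t := by linarith
  have hc : ∀ c, s c ≤ t * s c := fun c => le_mul_of_one_le_left (hs c) ht.le
  have hc' : ∀ c y, 0 < y → 1 / y * s c ≤ t * (1 / y * s c) := fun c y hy =>
    le_mul_of_one_le_left (mul_nonneg (by positivity) (hs c)) ht.le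
  have h1 : ∀ c y, 1 / y * s c = t * (1 / (t * y) * s c) := fun c y => by
    rw [one_div_mul_eq_div, one_div_mul_eq_div, ← mul_div_assoc, mul_div_mul_left _ _ ht0.ne']
  clear hd
  cases m <;> cases x <;> simp [params, pivot] at hx hxp <;>
    simp only [params, Finset.mem_insert, Finset.mem_singleton, forall_eq_or_imp,
      forall_eq] at key <;>
    simp only [R, T, scale, Function.update_self, ne_eq, reduceCtorEq,
      not_false_eq_true, Function.update_of_ne] <;>
    first
    | exact Or.inl ⟨trivial, trivial⟩
    | exact Or.inr ⟨trivial, trivial, Or.inl ⟨by ring1, trivial⟩⟩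
    | refine Or.inr ⟨trivial, trivial, Or.inr ⟨trivial, ?_⟩⟩
      try simp only [mul_assoc, mul_left_comm (d _) t]
      first
      | linarith [hc .ab, h1 .err (d .n)]
      | linarith [hc .abc, h1 .err (d .n)]
      | linarith [hc .vab, h1 .err (d .n)]
      | linarith [hc .ac, h1 .err (d .b * d .n)]
      | linarith [hc .ab, h1 .err (d .c * d .n)]
      | linarith [hc .ab, h1 .err (d .c * d .n), h1 .abc (d .c)]
      | linarith [hc .ab, h1 .err (d .c * d .n), hc' .abc (d .c) key.2.1]

end Model

/-! ### The pivot raises the power most -/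

namespace Model

variable {m : Model} {a α : ℝ} {e : Effects} {s : VarComp → ℝ} {d : Param → ℝ}

lemma noncentrality_pos (ha : 2 ≤ a) (he : e.Pos) (hs : ∀ c, 0 ≤ s c)
    (hact : 0 < m.activeVariance s) (hd : ∀ x ∈ m.params, 1 < d x) :
    0 < m.noncentrality a e s d :=
  div_pos (mul_pos (R_pos hd) (S_pos ha he hd)) (T_pos hs hact hd)

lemma noncentrality_scale_pivot (m : Model) (a : ℝ) (e : Effects) (s : VarComp → ℝ)
    (d : Param → ℝ) (t : ℝ) :
    m.noncentrality a e s (scale d m.pivot t) = t * m.noncentrality a e s d := by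
  rw [noncentrality, noncentrality, R_scale_pivot, S_scale_pivot, T_scale_pivot]
  ring

lemma one_lt_scale (hd : ∀ x ∈ m.params, 1 < d x) (x : Param) {t : ℝ} (ht : 1 ≤ t) :
    ∀ y ∈ m.params, 1 < scale d x t y := by
  intro y hy
  rcases eq_or_ne y x with rfl | h
  · rw [scale_same]
    nlinarith [hd y hy]
  · rw [scale_of_ne _ h]
    exact hd y hy

lemma noncentrality_scale_le (ha : 2 ≤ a) (he : e.Pos) (hs : ∀ c, 0 ≤ s c)
    (hact : 0 < m.activeVariance s) (hd : ∀ x ∈ m.params, 1 < d x) {x : Param}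
    (hx : x ∈ m.params) (hxp : x ≠ m.pivot) {t : ℝ} (ht : 1 < t) :
    m.noncentrality a e s (scale d x t) ≤ t * m.noncentrality a e s d := by
  have hR := R_pos hd
  have hT := T_pos hs hact hd
  have hS := S_pos ha he hd
  have hT' := T_pos hs hact (one_lt_scale hd x ht.le)
  rw [noncentrality, noncentrality]
  rcases R_T_scale_of_ne_pivot hs hd hx hxp ht with ⟨h1, h2⟩ | ⟨hu, hv, ⟨h1, h2⟩ | ⟨h1, h2⟩⟩
  · rw [h1, h2, ← mul_div_assoc, mul_left_comm]
    gcongr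
    exact S_scale_le ha he hd hx ht
  · rw [h1, h2, S_scale_of_ne hu hv, ← mul_div_assoc, mul_assoc]
  · rw [h1, S_scale_of_ne hu hv, ← mul_div_assoc, div_le_div_iff₀ hT' hT]
    nlinarith [mul_le_mul_of_nonneg_left h2 (mul_pos hR hS).le]

lemma power_lt_power_scale_pivot (ha : 2 ≤ a) (hα : α ∈ Ioo (0 : ℝ) 1) (he : e.Pos)
    (hs : ∀ c, 0 ≤ s c) (hact : 0 < m.activeVariance s) (hd : ∀ x ∈ m.params, 1 < d x) {t : ℝ}
    (ht : 1 < t) : m.power a α e s d < m.power a α e s (scale d m.pivot t) := by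
  have hc := df₂Factor_pos ha hd
  have hp := hd _ m.pivot_mem_params
  have hlt : m.df₂ a d < m.df₂ a (scale d m.pivot t) := by
    rw [df₂_scale_pivot, df₂_eq_factor_mul]
    exact mul_lt_mul_of_pos_left (by nlinarith) hc
  refine fTestPower_lt hα ?_ (df₁_scale_pivot m a d t).le (df₂_pos ha hd) hlt ?_
    (noncentrality_pos ha he hs hact hd) ?_
  · exact df₁_pos ha (one_lt_scale hd _ ht.le)
  · rw [df₁_scale_pivot]
    linarith
  · rw [noncentrality_scale_pivot]
    exact le_mul_of_one_le_left (noncentrality_pos ha he hs hact hd).le ht.le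

lemma power_scale_lt_power_scale_pivot (ha : 2 ≤ a) (hα : α ∈ Ioo (0 : ℝ) 1) (he : e.Pos)
    (hs : ∀ c, 0 ≤ s c) (hact : 0 < m.activeVariance s) (hd : ∀ x ∈ m.params, 1 < d x) {t : ℝ}
    (ht : 1 < t) {x : Param} (hx : x ∈ m.params) (hxp : x ≠ m.pivot) :
    m.power a α e s (scale d x t) < m.power a α e s (scale d m.pivot t) := by
  have hc := df₂Factor_pos ha hd
  have hp := hd _ m.pivot_mem_params
  have hdx := one_lt_scale hd x ht.le
  have h₁ := df₁_pos ha hd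
  have hct : 0 < (t - 1) * m.df₂Factor a d := mul_pos (sub_pos.2 ht) hc
  have hcp : 0 < m.df₂Factor a d * (d m.pivot - 1) := mul_pos hc (sub_pos.2 hp)
  have hcpt : 0 < (t - 1) * (m.df₂Factor a d * (d m.pivot - 1)) := mul_pos (sub_pos.2 ht) hcp
  -- These are the three conditions of `fTestPower_lt`. The middle one is strict because t(p - 1) <
  -- tp - 1 for t > 1.
  have key : m.df₁ a d ≤ m.df₁ a (scale d x t) ∧
      m.df₂ a (scale d x t) < m.df₂Factor a d * (t * d m.pivot - 1) ∧
      m.df₁ a (scale d x t) + m.df₂ a (scale d x t) ≤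
        m.df₁ a d + m.df₂Factor a d * (t * d m.pivot - 1) := by
    rcases df_scale_of_ne_pivot ha hd hx hxp t with ⟨h, h' | h'⟩ | ⟨h, h', hle⟩ <;>
      rw [h, h', df₂_eq_factor_mul m a d]
    · exact ⟨le_rfl, by linarith, by linarith⟩
    · exact ⟨le_rfl, by linarith, by linarith⟩
    · have := mul_le_mul_of_nonneg_left hle (sub_pos.2 ht).le
      exact ⟨le_mul_of_one_le_left h₁.le ht.le, by linarith, by linarith⟩
  refine fTestPower_lt hα (df₁_pos ha (one_lt_scale hd _ ht.le)) ?_ (df₂_pos ha hdx) ?_ ?_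
    (noncentrality_pos ha he hs hact hdx) ?_
  · rw [df₁_scale_pivot]; exact key.1
  · rw [df₂_scale_pivot]; exact key.2.1
  · rw [df₁_scale_pivot, df₂_scale_pivot]; exact key.2.2
  · rw [noncentrality_scale_pivot]
    exact noncentrality_scale_le ha he hs hact hd hx hxp ht

lemma continuousOn_power_scale_pivot (ha : 2 ≤ a) (hα : α ∈ Ioo (0 : ℝ) 1) (he : e.Pos)
    (hs : ∀ c, 0 ≤ s c) (hact : 0 < m.activeVariance s) (hd : ∀ x ∈ m.params, 1 < d x) :
    ContinuousOn (fun t => m.power a α e s (scale d m.pivot t)) (Ici 1) := by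
  intro t ht
  have ht : 1 ≤ t := ht
  have hdt := one_lt_scale hd m.pivot ht
  have h : (fun t => m.power a α e s (scale d m.pivot t)) =
      (fun q : ℝ × ℝ => fTestPower α (m.df₁ a d) q.1 q.2) ∘ fun t =>
        (m.df₂Factor a d * (t * d m.pivot - 1), t * m.noncentrality a e s d) := by
    funext t
    rw [power, df₁_scale_pivot, df₂_scale_pivot, noncentrality_scale_pivot]
    rfl
  rw [h]
  refine (ContinuousAt.comp ?_ (by fun_prop)).continuousWithinAt
  refine continuousAt_fTestPower hα (df₁_pos ha hd) ?_ ?_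
  · rw [← df₂_scale_pivot]
    exact df₂_pos ha hdt
  · rw [← noncentrality_scale_pivot]
    exact noncentrality_pos ha he hs hact hdt

end Model

/-! ### Shifting all excess to the pivot -/

namespace Model

variable {m : Model} {a α : ℝ} {e : Effects} {s : VarComp → ℝ} {L d : Param → ℝ}

lemma one_lt_of_mem_designs (hL : ∀ x ∈ m.params, 1 < L x) (hd : d ∈ m.designs L) :
    ∀ x ∈ m.params, 1 < d x := fun x hx => (hL x hx).trans_le (hd x hx)

lemma scale_mem_designs (hL : ∀ x ∈ m.params, 1 < L x) (hd : d ∈ m.designs L) (x : Param) {t : ℝ}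
    (ht : 1 ≤ t) : scale d x t ∈ m.designs L := by
  intro y hy
  rcases eq_or_ne y x with rfl | h
  · rw [scale_same]
    exact (hd y hy).trans (le_mul_of_one_le_left
      (by linarith [one_lt_of_mem_designs hL hd y hy]) ht)
  · rw [scale_of_ne _ h]
    exact hd y hy

lemma self_mem_designs (m : Model) (L : Param → ℝ) : L ∈ m.designs L := fun _ _ => le_rfl

lemma onlyPivotVaries_scale (m : Model) (L : Param → ℝ) (t : ℝ) :
    m.OnlyPivotVaries L (scale L m.pivot t) := fun _ _ hx => scale_of_ne _ hx _

lemma size_pos (ha : 2 ≤ a) (hd : ∀ x ∈ m.params, 1 < d x) : 0 < m.size a d :=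
  mul_pos (by linarith) (Finset.prod_pos fun x hx => by linarith [hd x hx])

open Classical in
/-- Shifting the excess of all other parameters to the pivot. -/
lemma exists_onlyPivotVaries (ha : 2 ≤ a) (hα : α ∈ Ioo (0 : ℝ) 1) (he : e.Pos)
    (hs : ∀ c, 0 ≤ s c) (hact : 0 < m.activeVariance s) (hL : ∀ x ∈ m.params, 1 < L x)
    (hd : d ∈ m.designs L) (hnot : ¬ m.OnlyPivotVaries L d) :
    ∃ d' ∈ m.designs L, m.OnlyPivotVaries L d' ∧ m.size a d' = m.size a d ∧
      d m.pivot < d' m.pivot ∧ m.power a α e s d < m.power a α e s d' := by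
  induction hn : (m.params.filter fun x => x ≠ m.pivot ∧ d x ≠ L x).card using
    Nat.strong_induction_on generalizing d with
  | _ n ih =>
  have hnot' := hnot
  simp only [OnlyPivotVaries, not_forall] at hnot'
  obtain ⟨x, hx, hxp, hxL⟩ := hnot'
  have hLx := hL x hx
  have hlt : L x < d x := lt_of_le_of_ne (hd x hx) (Ne.symm hxL)
  -- Reset x to its minimum, giving d₀, and let the pivot absorb the factor t instead: d is d₀ with
  -- x scaled by t, so the new design has the size of d and more power.
  set t := d x / L x with ht
  have ht1 : 1 < t := (one_lt_div (by linarith)).2 hlt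
  set d₀ := Function.update d x (L x) with hd₀
  have hd₀m : d₀ ∈ m.designs L := by
    intro y hy
    rcases eq_or_ne y x with rfl | h
    · simp [hd₀]
    · simpa [hd₀, h] using hd y hy
  have hscale : scale d₀ x t = d := by
    rw [scale, hd₀, Function.update_self, Function.update_idem, ht,
      div_mul_cancel₀ _ (by linarith), Function.update_eq_self]
  have h₁ := one_lt_of_mem_designs hL hd₀m
  have hpow : m.power a α e s d < m.power a α e s (scale d₀ m.pivot t) := by
    have := power_scale_lt_power_scale_pivot ha hα he hs hact h₁ ht1 hx hxp
    rwa [hscale] at this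
  have hsize : m.size a (scale d₀ m.pivot t) = m.size a d := by
    rw [size_scale m.pivot_mem_params, ← size_scale hx, hscale]
  have hpiv : d m.pivot < scale d₀ m.pivot t m.pivot := by
    have := h₁ _ m.pivot_mem_params
    have e : d₀ m.pivot = d m.pivot := by simp [hd₀, hxp.symm]
    rw [scale_same, e]
    rw [e] at this
    nlinarith
  have hmem := scale_mem_designs hL hd₀m m.pivot ht1.le
  by_cases honly : m.OnlyPivotVaries L (scale d₀ m.pivot t)
  · exact ⟨_, hmem, honly, hsize, hpiv, hpow⟩
  · have hcard : (m.params.filter fun y => y ≠ m.pivot ∧ scale d₀ m.pivot t y ≠ L y).card < n := by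
      rw [← hn]
      refine Finset.card_lt_card (Finset.ssubset_iff_subset_ne.2 ⟨fun y hy => ?_, fun h => ?_⟩)
      · rw [Finset.mem_filter] at hy ⊢
        obtain ⟨hy1, hy2, hy3⟩ := hy
        rw [scale_of_ne _ hy2] at hy3
        refine ⟨hy1, hy2, ?_⟩
        rcases eq_or_ne y x with rfl | hyx
        · exact hxL
        · simpa [hd₀, hyx] using hy3
      · have hx' : x ∈ m.params.filter fun y => y ≠ m.pivot ∧ d y ≠ L y :=
          Finset.mem_filter.2 ⟨hx, hxp, hxL⟩
        rw [← h, Finset.mem_filter, scale_of_ne _ hxp] at hx'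
        simp [hd₀] at hx'
    obtain ⟨d', h1, h2, h3, h4, h5⟩ := ih _ hcard hmem honly rfl
    exact ⟨d', h1, h2, h3.trans hsize, hpiv.trans h4, hpow.trans h5⟩

lemma OnlyPivotVaries.eq_scale (h : m.OnlyPivotVaries L d) (hL : ∀ x ∈ m.params, 1 < L x) :
    ∀ x ∈ m.params, d x = scale L m.pivot (d m.pivot / L m.pivot) x := by
  intro x hx
  rcases eq_or_ne x m.pivot with rfl | hxp
  · rw [scale_same, div_mul_cancel₀]
    linarith [hL _ m.pivot_mem_params]
  · rw [scale_of_ne _ hxp, h x hx hxp]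

/-- Every design is dominated by the design of the same size in which only the pivot varies. -/
lemma exists_scale_pivot (ha : 2 ≤ a) (hα : α ∈ Ioo (0 : ℝ) 1) (he : e.Pos)
    (hs : ∀ c, 0 ≤ s c) (hact : 0 < m.activeVariance s) (hL : ∀ x ∈ m.params, 1 < L x)
    (hd : d ∈ m.designs L) :
    ∃ t, 1 ≤ t ∧ m.size a d = t * m.size a L ∧
      (m.OnlyPivotVaries L d → m.power a α e s d = m.power a α e s (scale L m.pivot t)) ∧
      (¬ m.OnlyPivotVaries L d →
        1 < t ∧ m.power a α e s d < m.power a α e s (scale L m.pivot t)) := by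
  have hLp := hL _ m.pivot_mem_params
  by_cases h : m.OnlyPivotVaries L d
  · have heq := h.eq_scale hL
    refine ⟨d m.pivot / L m.pivot, (one_le_div (by linarith)).2 (hd _ m.pivot_mem_params), ?_,
      fun _ => power_congr heq _ _ _ _, fun h' => absurd h h'⟩
    rw [size_congr heq, size_scale m.pivot_mem_params]
  · obtain ⟨d', h1, h2, h3, h4, h5⟩ := exists_onlyPivotVaries ha hα he hs hact hL hd h
    have heq := h2.eq_scale hL
    have hlt : 1 < d' m.pivot / L m.pivot :=
      (one_lt_div (by linarith)).2 ((hd _ m.pivot_mem_params).trans_lt h4)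
    refine ⟨d' m.pivot / L m.pivot, hlt.le, ?_, fun h' => absurd h' h, fun _ => ⟨hlt, ?_⟩⟩
    · rw [← h3, size_congr heq, size_scale m.pivot_mem_params]
    · rwa [← power_congr heq]

lemma strictMonoOn_power_scale_pivot (ha : 2 ≤ a) (hα : α ∈ Ioo (0 : ℝ) 1) (he : e.Pos)
    (hs : ∀ c, 0 ≤ s c) (hact : 0 < m.activeVariance s) (hd : ∀ x ∈ m.params, 1 < d x) :
    StrictMonoOn (fun t => m.power a α e s (scale d m.pivot t)) (Ici 1) := by
  intro t ht u _ htu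
  have ht : 1 ≤ t := ht
  -- Going from t to u is one more scaling by u / t > 1, so the one-step comparison applies.
  have h : scale (scale d m.pivot t) m.pivot (u / t) = scale d m.pivot u := by
    rw [scale, scale_same, scale, Function.update_idem, ← mul_assoc, div_mul_cancel₀, scale]
    linarith
  have := power_lt_power_scale_pivot ha hα he hs hact (one_lt_scale hd m.pivot ht)
    ((one_lt_div (by linarith)).2 htu)
  rwa [h] at this

end Model

/-! ### The theorem: comparison with the ray of pivot designs -/

theorem theorem3 (m : Model) (a : ℕ) (ha : 2 ≤ a) (α : ℝ) (hα : α ∈ Ioo (0 : ℝ) 1)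
    (e : Effects) (he : e.Pos)
    (s : VarComp → ℝ) (hs : ∀ c, 0 ≤ s c) (hact : 0 < m.activeVariance s)
    (L : Param → ℝ) (hL : ∀ x ∈ m.params, 1 < L x) :
    -- increasing the pivot raises the power, and more than the same increase of another parameter
    (∀ d ∈ m.designs L, ∀ t : ℝ, 1 < t →
      m.power a α e s d < m.power a α e s (Model.scale d m.pivot t) ∧
      ∀ x ∈ m.params, x ≠ m.pivot →
        m.power a α e s (Model.scale d x t) < m.power a α e s (Model.scale d m.pivot t)) ∧
    -- fixed size: the power is maximal exactly if only the pivot varies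
    (∀ N : ℝ, m.size a L ≤ N →
      (∃ d ∈ m.designs L, m.size a d = N ∧ m.OnlyPivotVaries L d) ∧
      ∀ d ∈ m.designs L, m.size a d = N →
        (IsMaxOn (m.power a α e s) {d' ∈ m.designs L | m.size a d' = N} d ↔
          m.OnlyPivotVaries L d)) ∧
    -- fixed power: the size is minimal exactly if only the pivot varies
    (∀ P : ℝ, m.power a α e s L ≤ P → (∃ d ∈ m.designs L, m.power a α e s d = P) →
      (∃ d ∈ m.designs L, m.power a α e s d = P ∧ m.OnlyPivotVaries L d) ∧
      ∀ d ∈ m.designs L, m.power a α e s d = P →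
        (IsMinOn (m.size a) {d' ∈ m.designs L | m.power a α e s d' = P} d ↔
          m.OnlyPivotVaries L d)) ∧
    -- required power: the minimal size is attained, and only if only the pivot varies
    (∀ P : ℝ, (∃ d ∈ m.designs L, P ≤ m.power a α e s d) →
      (∃ d ∈ m.designs L, P ≤ m.power a α e s d ∧
        IsMinOn (m.size a) {d' ∈ m.designs L | P ≤ m.power a α e s d'} d) ∧
      ∀ d ∈ m.designs L, P ≤ m.power a α e s d →
        IsMinOn (m.size a) {d' ∈ m.designs L | P ≤ m.power a α e s d'} d →
          m.OnlyPivotVaries L d) := by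

  have ha' : (2 : ℝ) ≤ a := by exact_mod_cast ha
  set f : ℝ → ℝ := fun t => m.power a α e s (Model.scale L m.pivot t) with hf
  have hmono : StrictMonoOn f (Ici 1) :=
    Model.strictMonoOn_power_scale_pivot ha' hα he hs hact hL
  have hcont : ContinuousOn f (Ici 1) :=
    Model.continuousOn_power_scale_pivot ha' hα he hs hact hL
  have hsL : 0 < m.size a L := Model.size_pos ha' hL
  have hsize : ∀ t, m.size a (Model.scale L m.pivot t) = t * m.size a L := fun t =>
    Model.size_scale m.pivot_mem_params a t
  have hmem : ∀ t, 1 ≤ t → Model.scale L m.pivot t ∈ m.designs L := fun t ht =>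
    Model.scale_mem_designs hL (m.self_mem_designs L) _ ht
  have hcanon := fun {d} (hd : d ∈ m.designs L) =>
    Model.exists_scale_pivot ha' hα he hs hact hL hd
  have hone : f 1 = m.power a α e s L := by
    simp only [hf, Model.scale, one_mul, Function.update_eq_self]
  -- The number t is determined by the size of d, so the size bounds the power of any design by the
  -- value of f at its relative size.
  have hdom : ∀ d ∈ m.designs L, ∃ t, 1 ≤ t ∧ m.size a d = t * m.size a L ∧
      m.power a α e s d ≤ f t := by
    intro d hd
    obtain ⟨t, ht, hst, h1, h2⟩ := hcanon hd
    refine ⟨t, ht, hst, ?_⟩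
    by_cases h : m.OnlyPivotVaries L d
    exacts [(h1 h).le, (h2 h).2.le]
  -- Any design of power at least P gives a point on the ray with power at least P, so the
  -- intermediate value theorem applies between 1 and this point.
  have hivt : ∀ P, f 1 ≤ P → (∃ d ∈ m.designs L, P ≤ m.power a α e s d) → ∃ t, 1 ≤ t ∧ f t = P := by
    rintro P hP ⟨d, hd, hdP⟩
    obtain ⟨t, ht, -, hle⟩ := hdom d hd
    obtain ⟨u, hu, huP⟩ := intermediate_value_Icc ht (hcont.mono Icc_subset_Ici_self)
      ⟨hP, hdP.trans hle⟩
    exact ⟨u, hu.1, huP⟩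
  refine ⟨fun d hd t ht => ?_, fun N hN => ?_, fun P hP hex => ?_, fun P hex => ?_⟩
  · have h1 := Model.one_lt_of_mem_designs hL hd
    exact ⟨Model.power_lt_power_scale_pivot ha' hα he hs hact h1 ht, fun x hx hxp =>
      Model.power_scale_lt_power_scale_pivot ha' hα he hs hact h1 ht hx hxp⟩
  · refine ⟨⟨Model.scale L m.pivot (N / m.size a L), hmem _ ((one_le_div hsL).2 hN), ?_,
      m.onlyPivotVaries_scale L _⟩, fun d hd hdN => ⟨fun hmax => ?_, fun h d' hd' => ?_⟩⟩
    · rw [hsize, div_mul_cancel₀ _ hsL.ne']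
    · by_contra h
      obtain ⟨t, ht, hst, -, h2⟩ := hcanon hd
      exact absurd (hmax ⟨hmem t ht, by rw [hsize, ← hst, hdN]⟩) (not_le.2 (h2 h).2)
    · obtain ⟨t, ht, hst, h1, -⟩ := hcanon hd
      obtain ⟨u, hu, hsu, hle⟩ := hdom d' hd'.1
      have : u = t := mul_right_cancel₀ hsL.ne' (by rw [← hst, ← hsu, hdN, hd'.2])
      subst this
      exact hle.trans (h1 h).ge
  · obtain ⟨d₀, hd₀, hd₀P⟩ := hex
    obtain ⟨u, hu, huP⟩ := hivt P (hone.trans_le hP) ⟨d₀, hd₀, hd₀P.ge⟩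
    refine ⟨⟨Model.scale L m.pivot u, hmem u hu, huP, m.onlyPivotVaries_scale L _⟩,
      fun d hd hdP => ⟨fun hmin => ?_, fun h d' hd' => ?_⟩⟩
    · by_contra h
      obtain ⟨t, ht, hst, -, h2⟩ := hcanon hd
      -- A design that varies another parameter has power P strictly below f t, so the ray reaches P
      -- already at some u < t, with a smaller size.
      have hut : u < t := (hmono.lt_iff_lt hu ht).1 (by rw [huP, ← hdP]; exact (h2 h).2)
      have hle : m.size a d ≤ m.size a (Model.scale L m.pivot u) := hmin ⟨hmem u hu, huP⟩
      rw [hst, hsize] at hle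
      exact absurd (le_of_mul_le_mul_right hle hsL) (not_le.2 hut)
    · obtain ⟨t, ht, hst, h1, -⟩ := hcanon hd
      obtain ⟨v, hv, hsv, hle⟩ := hdom d' hd'.1
      have htv : t ≤ v := (hmono.le_iff_le ht hv).1 (by
        rw [hd'.2] at hle
        exact ((h1 h).symm.trans hdP).trans_le hle)
      change m.size a d ≤ m.size a d'
      rw [hst, hsv]
      exact mul_le_mul_of_nonneg_right htv hsL.le
  -- Here u is the least point of the ray with power at least P: the point 1 if P ≤ f 1, otherwise
  -- the solution of f u = P. When u = 1, `hstrict` rests on 1 < t alone, which is why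
  -- `exists_scale_pivot` also supplies that inequality.
  · obtain ⟨u, hu, huP, hmin, hstrict⟩ : ∃ u, 1 ≤ u ∧ P ≤ f u ∧ (∀ t, 1 ≤ t → P ≤ f t → u ≤ t) ∧
        ∀ t, 1 < t → P < f t → u < t := by
      rcases le_total P (f 1) with h | h
      · exact ⟨1, le_rfl, h, fun t ht _ => ht, fun t ht _ => ht⟩
      · obtain ⟨u, hu, huP⟩ := hivt P h hex
        exact ⟨u, hu, huP.ge, fun t ht htP => (hmono.le_iff_le hu ht).1 (huP.trans_le htP),
          fun t ht htP => (hmono.lt_iff_lt hu ht.le).1 (huP.trans_lt htP)⟩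
    refine ⟨⟨Model.scale L m.pivot u, hmem u hu, huP, fun d hd => ?_⟩, fun d hd hdP hdmin => ?_⟩
    · obtain ⟨t, ht, hst, hle⟩ := hdom d hd.1
      change m.size a (Model.scale L m.pivot u) ≤ m.size a d
      rw [hst, hsize]
      exact mul_le_mul_of_nonneg_right (hmin t ht (hd.2.trans hle)) hsL.le
    · by_contra h
      obtain ⟨t, ht, hst, -, h2⟩ := hcanon hd
      obtain ⟨ht1, hlt⟩ := h2 h
      have hut := hstrict t ht1 (hdP.trans_lt hlt)
      have hle : m.size a d ≤ m.size a (Model.scale L m.pivot u) := hdmin ⟨hmem u hu, huP⟩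
      rw [hst, hsize] at hle
      exact absurd (le_of_mul_le_mul_right hle hsL) (not_le.2 hut)
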